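/- Let $p$ be a prime, let $A=\mathbb Z_p=\mathbb Z/p\mathbb Z$, and let $L$ be a finite connected simplicial complex. Then there are an integer $m\ge 0$, a finite simplicial complex $\hat L$ and a simplicial action of $A^m$ on $\hat L$ such that the orbit space $\hat L/A^m$ is a subdivision of $L$ (that is, there are a subdivision $L'$ of $L$ and a simplicial map $f:\hat L\to L'$ whose map of polyhedra is surjective and has exactly the $A^m$-orbits as its fibres), and such that the orbit map $f:|\hat L|\to |L'|=|L|$ has the following property: for every simplex $\sigma$ of $L$, the inclusion $f^{-1}(\partial\sigma)\hookrightarrow f^{-1}(\sigma)$ of subpolyhedra of $\hat L$ induces an isomorphism $H_1(f^{-1}(\partial\sigma);\mathbb Z_p)\to H_1(f^{-1}(\sigma);\mathbb Z_p)$. (Here $\partial\sigma$ is the union of the proper faces of $\sigma$; it is empty if $\sigma$ is a vertex.) -/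

import Mathlib

/-! Simplicial homology in degree one.  The complex used is the ordered chain complex: `C_n(K; R)`
is free on the tuples `(v_0, …, v_n)` of vertices (repetitions allowed) that span a simplex. -/

namespace SimplicialHomology

/-- The simplicial boundary `∂ (v_0, …, v_{n+1}) = ∑ i, (-1)^i (v_0, …, v̂_i, …, v_{n+1})`. -/
noncomputable def boundary (R : Type*) [CommRing R] (V : Type*) (n : ℕ) :
    ((Fin (n + 2) → V) →₀ R) →ₗ[R] ((Fin (n + 1) → V) →₀ R) :=
  Finsupp.linearCombination R fun s : Fin (n + 2) → V =>
    ∑ i : Fin (n + 2), Finsupp.single (s ∘ i.succAbove) ((-1 : R) ^ (i : ℕ))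

/-- `C_n(K; R)`, as the submodule of formal combinations of tuples that span a simplex of `K`. -/
def chains (R : Type*) [CommRing R] {V : Type*} (K : PreAbstractSimplicialComplex V) (n : ℕ) :
    Submodule R ((Fin (n + 1) → V) →₀ R) :=
  Finsupp.supported R R {s | ∃ t ∈ K.faces, (t : Set V) = Set.range s}

/-- `Z_1(K; R)`. -/
noncomputable def oneCycles (R : Type*) [CommRing R] {V : Type*}
    (K : PreAbstractSimplicialComplex V) : Submodule R ((Fin 2 → V) →₀ R) :=
  chains R K 1 ⊓ LinearMap.ker (boundary R V 0)

/-- `B_1(K; R)`. -/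
noncomputable def oneBoundaries (R : Type*) [CommRing R] {V : Type*}
    (K : PreAbstractSimplicialComplex V) : Submodule R ((Fin 2 → V) →₀ R) :=
  (chains R K 2).map (boundary R V 1)

noncomputable instance instAddCommGroupOneCycles (R : Type*) [CommRing R] {V : Type*} (K : PreAbstractSimplicialComplex V) :
    AddCommGroup (oneCycles R K) :=
  Submodule.addCommGroup (oneCycles R K)

/-- `H_1(K; R) = Z_1(K; R) / B_1(K; R)`. -/
abbrev H1 (R : Type*) [CommRing R] {V : Type*} (K : PreAbstractSimplicialComplex V) : Type _ :=
  oneCycles R K ⧸ (oneBoundaries R K).submoduleOf (oneCycles R K)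

theorem chains_mono (R : Type*) [CommRing R] {V : Type*} {K K' : PreAbstractSimplicialComplex V}
    (h : K ≤ K') (n : ℕ) : chains R K n ≤ chains R K' n :=
  Finsupp.supported_mono fun _ ⟨t, ht, hs⟩ => ⟨t, h ht, hs⟩

theorem oneCycles_mono (R : Type*) [CommRing R] {V : Type*}
    {K K' : PreAbstractSimplicialComplex V} (h : K ≤ K') : oneCycles R K ≤ oneCycles R K' :=
  inf_le_inf_right _ (chains_mono R h 1)

theorem oneBoundaries_mono (R : Type*) [CommRing R] {V : Type*}
    {K K' : PreAbstractSimplicialComplex V} (h : K ≤ K') :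
    oneBoundaries R K ≤ oneBoundaries R K' :=
  Submodule.map_mono (chains_mono R h 2)

/-- The map `H_1(K; R) → H_1(K'; R)` induced by the inclusion of a subcomplex `K` of `K'`. -/
noncomputable def H1map (R : Type*) [CommRing R] {V : Type*}
    {K K' : PreAbstractSimplicialComplex V} (h : K ≤ K') : H1 R K →ₗ[R] H1 R K' :=
  Submodule.mapQ _ _ (Submodule.inclusion (oneCycles_mono R h)) fun _ hx =>
    oneBoundaries_mono R h hx

end SimplicialHomology

namespace SimplicialOrbit

/-- The polyhedron `|K|` of a finite abstract complex, in barycentric coordinates. -/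
def polyhedron {V : Type*} [Fintype V] (K : PreAbstractSimplicialComplex V) : Set (V → ℝ) :=
  {x | x ∈ stdSimplex ℝ V ∧ ∃ s ∈ K.faces, ∀ v, x v ≠ 0 → v ∈ s}

/-- The extension of a vertex map `φ` to barycentric coordinates, affine on every simplex. -/
def affineExtension {V E : Type*} [Fintype V] [AddCommGroup E] [Module ℝ E]
    (φ : V → E) (x : V → ℝ) : E :=
  ∑ v, x v • φ v

/-- The subcomplex of all simplices of `K` whose polyhedron is sent by `f` into the set `S`. -/
def preimage {V E : Type*} [Fintype V] (K : PreAbstractSimplicialComplex V)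
    (f : (V → ℝ) → E) (S : Set E) : PreAbstractSimplicialComplex V where
  faces := {s | s ∈ K.faces ∧ ∀ x ∈ stdSimplex ℝ V, (∀ v, x v ≠ 0 → v ∈ s) → f x ∈ S}
  isRelLowerSet_faces := fun _ ⟨hs, hf⟩ =>
    ⟨(K.isRelLowerSet_faces hs).1, fun _ hts ht =>
      ⟨(K.isRelLowerSet_faces hs).2 hts ht, fun x hx hxt => hf x hx fun v hv => hts (hxt v hv)⟩⟩

theorem preimage_mono {V E : Type*} [Fintype V] (K : PreAbstractSimplicialComplex V)
    (f : (V → ℝ) → E) {S T : Set E} (h : S ⊆ T) : preimage K f S ≤ preimage K f T :=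
  fun _ ⟨hs, hf⟩ => ⟨hs, fun x hx hxs => h (hf x hx hxs)⟩

/-- The closed simplex with vertex set `σ`. -/
def closedSimplex {E : Type*} [AddCommGroup E] [Module ℝ E] (σ : Finset E) : Set E :=
  convexHull ℝ (σ : Set E)

/-- The boundary `∂σ` of the simplex with vertex set `σ`: the union of its proper faces
(the boundary of a vertex is empty). -/
def simplexBoundary {E : Type*} [AddCommGroup E] [Module ℝ E] (σ : Finset E) : Set E :=
  ⋃ τ : Finset E, ⋃ _ : τ ⊂ σ, closedSimplex τ

theorem simplexBoundary_subset {E : Type*} [AddCommGroup E] [Module ℝ E] (σ : Finset E) :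
    simplexBoundary σ ⊆ closedSimplex σ :=
  Set.iUnion₂_subset fun _ hτ => convexHull_mono (Finset.coe_subset.2 hτ.1)

/-- `L'` is a subdivision of `L`: every simplex of `L'` lies in a simplex of `L`, and every simplex
of `L` is the union of finitely many simplices of `L'`. -/
structure IsSubdivision {E : Type*} [AddCommGroup E] [Module ℝ E]
    (L' L : Geometry.SimplicialComplex ℝ E) : Prop where
  subset_simplex : ∀ s ∈ L'.faces, ∃ t ∈ L.faces, closedSimplex s ⊆ closedSimplex t
  eq_union : ∀ t ∈ L.faces, ∃ F : Set (Finset E),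
    F.Finite ∧ F ⊆ L'.faces ∧ closedSimplex t = ⋃ s ∈ F, closedSimplex s

/-- The action of `G` on the vertices of `K` is simplicial: it sends simplices to simplices. -/
def IsSimplicialAction (G : Type*) [AddGroup G] {V : Type*} [AddAction G V]
    (K : PreAbstractSimplicialComplex V) : Prop :=
  ∀ g : G, ∀ s ∈ K.faces, s.map (AddAction.toPerm g).toEmbedding ∈ K.faces

/-- The vertex map `φ` presents `L'` as the orbit space of the action of `G` on `K`: it is a
simplicial map from `K` to `L'`, and its extension to polyhedra maps `|K|` onto `|L'|` and has the
orbits of `G` in `|K|` as its fibres.  (So it induces a bijection from `|K| / G` to `|L'|`; this is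
a homeomorphism since `K` is finite.) -/
structure IsOrbitMap (G : Type*) [AddGroup G] {V E : Type*} [Fintype V] [AddAction G V]
    [AddCommGroup E] [Module ℝ E] (K : PreAbstractSimplicialComplex V)
    (L' : Geometry.SimplicialComplex ℝ E) (φ : V → E) : Prop where
  simplicial : ∀ s ∈ K.faces, ∃ t ∈ L'.faces, (t : Set E) = φ '' (s : Set V)
  image_eq : affineExtension φ '' polyhedron K = L'.space
  fibre_eq_orbit : ∀ x ∈ polyhedron K, ∀ y ∈ polyhedron K,
    affineExtension φ x = affineExtension φ y ↔ ∃ g : G, ∀ v, y (g +ᵥ v) = x v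

end SimplicialOrbit

/-! Let each point over `L` remember a one-chain that connects vertices. To a chain of simplices of
`L` attach potentials `u` with values in the one-chains over `ZMod p` of the complete graph on the
vertices, taken up to a constant. For `τ ⊆ σ` in the chain, `u σ - u τ` has to lie in the coset of
`edge (base σ) (base τ)` modulo `triangles σ`, the one-cycles of the complete graph on `σ`. Ordered
by restriction these pairs form a poset, and its order complex `cover` is the complex sought. The
product of all `triangles σ` acts by adding to `u`; it is a finite-dimensional space over `ZMod p`,
hence of the form $A^m$. It is transitive on the potentials over a fixed chain (`exists_vadd_eq`),
so the orbit space is the order complex of the chains of simplices, which is the second barycentric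
subdivision of `L`.

For the homology, the change of the potential along one-chains (`chainChange`) is a cocycle and so
kills boundaries. In the other direction, over any family of simplices closed under nonempty faces,
a cycle `c` is homologous to minus the lift to the cover of the graph chain `chainChange c`
(`mem_oneBoundaries_add_liftEdges`). This rests on `defect_pair_eq_zero`: a loop that passes from
`τ` to `σ` in the cover and returns along lifted edges as the potential prescribes is a boundary.
The proof is by induction on `σ`. Moving the lower end of the passage from one vertex of `σ` to
another across an edge of `σ` adds that edge to the potential difference; going round a triangle
therefore changes the difference by that triangle without changing the class of the loop. Hence all
admissible differences give the same class, and one of them gives zero.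

Now let `σ` be a simplex. A cycle over `∂σ` that bounds over `σ` has zero change, hence already
bounds over `∂σ`. A cycle over `σ` is homologous to a lift of edges of `σ`, and these lie over `∂σ`
as soon as `σ` has more than two vertices. If it has at most two, no nonzero lift of edges of `σ` is
a cycle, so the cycle bounds. Both halves are in `H1map_coverOver_bijective`. -/

namespace SimplicialOrbit

/-! ### Barycentric coordinates and barycentric subdivision. -/

section AffineExtension

variable {V W E : Type*} [AddCommGroup E] [Module ℝ E]

theorem affineExtension_comp [Fintype V] [Fintype W] (φ : V → W → ℝ) (ψ : W → E) (x : V → ℝ) :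
    affineExtension ψ (affineExtension φ x) =
      affineExtension (fun v => affineExtension ψ (φ v)) x := by
  simp only [affineExtension, Finset.sum_apply, Pi.smul_apply, Finset.sum_smul, Finset.smul_sum,
    smul_eq_mul, mul_smul]
  exact Finset.sum_comm

theorem affineExtension_apply [Fintype V] (φ : V → W → ℝ) (x : V → ℝ) (w : W) :
    affineExtension φ x w = ∑ v, x v * φ v w := by
  simp [affineExtension, Finset.sum_apply]

theorem affineExtension_congr [Fintype V] {φ ψ : V → E} {x : V → ℝ} (h : ∀ v, x v ≠ 0 → φ v = ψ v) :
    affineExtension φ x = affineExtension ψ x := by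
  refine Finset.sum_congr rfl fun v _ => ?_
  by_cases hv : x v = 0
  · simp [hv]
  · rw [h v hv]

theorem affineExtension_single [Fintype V] [DecidableEq V] (φ : V → E) (v : V) :
    affineExtension φ (Pi.single v 1) = φ v := by
  simp [affineExtension, Pi.single_apply, ite_smul]

theorem affineExtension_eq_sum_support [Fintype V] (φ : V → E) (x : V → ℝ) :
    affineExtension φ x = ∑ v ∈ Finset.univ.filter (fun v => x v ≠ 0), x v • φ v := by
  refine (Finset.sum_filter_of_ne (p := fun v => x v ≠ 0) fun v _ h hv => h ?_).symm
  rw [hv, zero_smul]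

theorem affineExtension_mem_stdSimplex [Fintype V] [Fintype W] {φ : V → W → ℝ} {x : V → ℝ} (hx : x ∈ stdSimplex ℝ V)
    (hφ : ∀ v, x v ≠ 0 → φ v ∈ stdSimplex ℝ W) : affineExtension φ x ∈ stdSimplex ℝ W := by
  rw [affineExtension_eq_sum_support]
  refine (convex_stdSimplex ℝ W).sum_mem (fun v _ => hx.1 v) ?_ fun v hv =>
    hφ v (Finset.mem_filter.1 hv).2
  rw [Finset.sum_filter_ne_zero]
  exact hx.2

theorem affineExtension_ne_zero_iff [Fintype V] {φ : V → W → ℝ} {x : V → ℝ} (hx : x ∈ stdSimplex ℝ V)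
    (hφ : ∀ v w, 0 ≤ φ v w) (w : W) :
    affineExtension φ x w ≠ 0 ↔ ∃ v, x v ≠ 0 ∧ φ v w ≠ 0 := by
  rw [affineExtension_apply, Ne, Finset.sum_eq_zero_iff_of_nonneg
    fun v _ => mul_nonneg (hx.1 v) (hφ v w)]
  simp

theorem exists_ne_zero_of_mem_stdSimplex [Fintype V] {x : V → ℝ} (hx : x ∈ stdSimplex ℝ V) :
    ∃ v, x v ≠ 0 := by
  by_contra! h
  have := hx.2
  simp [h] at this

/-- This translates between geometric simplices and coordinate vectors with prescribed support. No
injectivity of `φ` is needed, so it can be used before `φ` is known to embed the complex. -/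
theorem mem_convexHull_image_iff [Fintype V] (φ : V → E) (s : Set V) (z : E) :
    z ∈ convexHull ℝ (φ '' s) ↔
      ∃ x ∈ stdSimplex ℝ V, (∀ v, x v ≠ 0 → v ∈ s) ∧ affineExtension φ x = z := by
  classical
  constructor
  · intro hz
    refine convexHull_min (t := {z | ∃ x ∈ stdSimplex ℝ V, (∀ v, x v ≠ 0 → v ∈ s) ∧
      affineExtension φ x = z}) ?_ ?_ hz
    · rintro _ ⟨v, hv, rfl⟩
      refine ⟨Pi.single v 1, single_mem_stdSimplex ℝ v, fun w hw => ?_, ?_⟩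
      · by_cases h : w = v
        · exact h ▸ hv
        · simp [h] at hw
      · exact affineExtension_single φ v
    · rintro _ ⟨x, hx, hxs, rfl⟩ _ ⟨y, hy, hys, rfl⟩ a b ha hb hab
      refine ⟨a • x + b • y, convex_stdSimplex ℝ V hx hy ha hb hab, fun v hv => ?_, ?_⟩
      · by_contra hvs
        have h1 : x v = 0 := by_contra fun h => hvs (hxs v h)
        have h2 : y v = 0 := by_contra fun h => hvs (hys v h)
        simp [h1, h2] at hv
      · simp [affineExtension, add_smul, mul_smul, Finset.sum_add_distrib, Finset.smul_sum]
  · rintro ⟨x, hx, hxs, rfl⟩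
    rw [affineExtension_eq_sum_support]
    refine (convex_convexHull ℝ _).sum_mem (fun v _ => hx.1 v) ?_ fun v hv =>
      subset_convexHull ℝ _ ⟨v, hxs v (Finset.mem_filter.1 hv).2, rfl⟩
    rw [Finset.sum_filter_ne_zero]
    exact hx.2

theorem mem_closedSimplex_image_iff [Fintype V] [DecidableEq E] (φ : V → E) (s : Finset V) (z : E) :
    z ∈ closedSimplex (s.image φ) ↔
      ∃ x ∈ stdSimplex ℝ V, (∀ v, x v ≠ 0 → v ∈ s) ∧ affineExtension φ x = z := by
  rw [closedSimplex, Finset.coe_image, mem_convexHull_image_iff]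
  rfl

/-- The barycentre of the simplex `s`. -/
noncomputable def uniformWeight (s : Finset V) (v : V) : ℝ :=
  open Classical in if v ∈ s then (s.card : ℝ)⁻¹ else 0

theorem uniformWeight_nonneg (s : Finset V) (v : V) : 0 ≤ uniformWeight s v := by
  unfold uniformWeight
  split_ifs <;> positivity

theorem uniformWeight_ne_zero_iff (s : Finset V) (v : V) : uniformWeight s v ≠ 0 ↔ v ∈ s := by
  unfold uniformWeight
  split_ifs with h
  · simpa [h] using Finset.nonempty_iff_ne_empty.1 ⟨v, h⟩
  · simp [h]

theorem uniformWeight_mem_stdSimplex [Fintype V] {s : Finset V} (hs : s.Nonempty) :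
    uniformWeight s ∈ stdSimplex ℝ V := by
  classical
  refine ⟨uniformWeight_nonneg s, ?_⟩
  simp only [uniformWeight, Finset.sum_ite_mem, Finset.univ_inter, Finset.sum_const, nsmul_eq_mul]
  exact mul_inv_cancel₀ (by exact_mod_cast hs.card_pos.ne')

/-- The barycentric subdivision: its simplices are the chains of simplices. -/
def barycentricSubdivision (K : PreAbstractSimplicialComplex V) :
    PreAbstractSimplicialComplex (Finset V) where
  faces := {c | c.Nonempty ∧ (∀ s ∈ c, s ∈ K.faces) ∧
    IsChain (fun s t : Finset V => s ⊆ t) (c : Set (Finset V))}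
  isRelLowerSet_faces := fun _ ⟨h0, h1, h2⟩ => ⟨h0, fun _ hts ht =>
    ⟨ht, fun s hs => h1 s (hts hs), h2.mono (Finset.coe_subset.2 hts)⟩⟩

theorem exists_max_of_chain {c : Finset (Finset V)} (h0 : c.Nonempty)
    (hc : IsChain (· ⊆ ·) (c : Set (Finset V))) : ∃ s ∈ c, ∀ t ∈ c, t ⊆ s := by
  obtain ⟨s, hs, hmax⟩ := c.exists_maximal h0
  refine ⟨s, hs, fun t ht => ?_⟩
  rcases hc.total ht hs with h | h
  · exact h
  · exact hmax ht h

theorem barycentre_mem_polyhedron [Fintype V] {K : PreAbstractSimplicialComplex V} {w : Finset V → ℝ}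
    (hw : w ∈ polyhedron (barycentricSubdivision K)) :
    affineExtension uniformWeight w ∈ polyhedron K := by
  obtain ⟨hw, c, ⟨hc0, hcK, hc⟩, hwc⟩ := hw
  refine ⟨affineExtension_mem_stdSimplex hw fun s hs =>
    uniformWeight_mem_stdSimplex (K.isRelLowerSet_faces (hcK s (hwc s hs))).1, ?_⟩
  obtain ⟨s, hs, hmax⟩ := exists_max_of_chain hc0 hc
  refine ⟨s, hcK s hs, fun v hv => ?_⟩
  obtain ⟨t, ht, htv⟩ := (affineExtension_ne_zero_iff hw uniformWeight_nonneg v).1 hv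
  exact hmax t (hwc t ht) ((uniformWeight_ne_zero_iff t v).1 htv)

/-- Let `s` be the largest member with nonzero coefficient. A vertex of `s` in no other such member
forces `f s = 0`. If there is no such vertex, the other members cover `s`, and then the largest of
them already equals `s`. -/
theorem sum_indicator_eq_zero {c : Finset (Finset V)} (hc : IsChain (· ⊆ ·) (c : Set (Finset V)))
    (hne : ∀ s ∈ c, s.Nonempty) (f : Finset V → ℝ)
    (hf : ∀ v, ∑ s ∈ c, f s * uniformWeight s v = 0) : ∀ s ∈ c, f s = 0 := by
  classical
  by_contra! h
  obtain ⟨s₀, hs₀, hfs₀⟩ := h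
  obtain ⟨s, hs, hmax⟩ := exists_max_of_chain (c := c.filter (fun s => f s ≠ 0))
    ⟨s₀, Finset.mem_filter.2 ⟨hs₀, hfs₀⟩⟩
    (hc.mono (Finset.coe_subset.2 (Finset.filter_subset _ _)))
  rw [Finset.mem_filter] at hs
  by_cases hex : ∃ v ∈ s, ∀ t ∈ c, f t ≠ 0 → t ≠ s → v ∉ t
  · obtain ⟨v, hv, hvt⟩ := hex
    have h1 := hf v
    rw [Finset.sum_eq_single_of_mem s hs.1] at h1
    · exact (mul_ne_zero hs.2 ((uniformWeight_ne_zero_iff s v).2 hv)) h1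
    · intro t ht hts
      by_cases h0 : f t = 0
      · simp [h0]
      · have := hvt t ht h0 hts
        rw [← uniformWeight_ne_zero_iff, not_not] at this
        simp [this]
  · push Not at hex
    have hS : ((c.filter (fun t => f t ≠ 0)).erase s).Nonempty := by
      obtain ⟨v, hv⟩ := hne s hs.1
      obtain ⟨t, h1, h2, h3, -⟩ := hex v hv
      exact ⟨t, by simp [h1, h2, h3]⟩
    obtain ⟨r, hr, hrmax⟩ := exists_max_of_chain hS (hc.mono (Finset.coe_subset.2
      ((Finset.erase_subset _ _).trans (Finset.filter_subset _ _))))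
    rw [Finset.mem_erase] at hr
    refine hr.1 (Finset.Subset.antisymm (hmax r hr.2) fun v hv => ?_)
    obtain ⟨t, h1, h2, h3, h4⟩ := hex v hv
    exact hrmax t (by simp [h1, h2, h3]) h4

/-- If `s` carries positive weight, the coordinates of the point are strictly larger on `s` than off
`s`. So the sets that carry weight are superlevel sets of the point itself, and any two of these are
nested, even when they come from different weights. -/
theorem subset_or_subset_of_barycentre_eq [Fintype V] {K : PreAbstractSimplicialComplex V}
    {w w' : Finset V → ℝ} (hw : w ∈ polyhedron (barycentricSubdivision K))
    (hw' : w' ∈ polyhedron (barycentricSubdivision K))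
    (h : affineExtension uniformWeight w = affineExtension uniformWeight w')
    {s s' : Finset V} (hs : w s ≠ 0) (hs' : w' s' ≠ 0) : s ⊆ s' ∨ s' ⊆ s := by
  have key : ∀ {w : Finset V → ℝ} (_ : w ∈ polyhedron (barycentricSubdivision K)) {s : Finset V}
      (_ : w s ≠ 0) {a b : V} (_ : a ∈ s) (_ : b ∉ s),
      affineExtension uniformWeight w b < affineExtension uniformWeight w a := by
    intro w hw s hs a b ha hb
    obtain ⟨hw, c, ⟨hc0, hcK, hc⟩, hwc⟩ := hw
    rw [affineExtension_apply, affineExtension_apply]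
    have hle : ∀ t, t ≠ s → w t ≠ 0 → uniformWeight t b ≤ uniformWeight t a := by
      intro t hts ht
      by_cases hbt : b ∈ t
      · have hat : a ∈ t := by
          rcases hc.total (hwc t ht) (hwc s hs) with h | h
          · exact absurd (h hbt) hb
          · exact h ha
        simp [uniformWeight, hbt, hat]
      · have := (uniformWeight_ne_zero_iff t b).not.2 hbt
        rw [not_not] at this
        rw [this]
        exact uniformWeight_nonneg t a
    refine Finset.sum_lt_sum (fun t _ => ?_) ⟨s, Finset.mem_univ s, ?_⟩
    · by_cases ht : w t = 0
      · simp [ht]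
      · by_cases hts : t = s
        · subst hts
          simp only [uniformWeight, hb, ha, if_true, if_false, mul_zero]
          exact mul_nonneg (hw.1 t) (by positivity)
        · exact mul_le_mul_of_nonneg_left (hle t hts ht) (hw.1 t)
    · have hpos : 0 < w s := lt_of_le_of_ne (hw.1 s) hs.symm
      have h1 : 0 < s.card := Finset.card_pos.2 ⟨a, ha⟩
      simp only [uniformWeight, hb, ha, if_true, if_false, mul_zero]
      positivity
  by_contra! hcon
  obtain ⟨h1, h2⟩ := hcon
  obtain ⟨a, ha, ha'⟩ := Finset.not_subset.1 h1
  obtain ⟨b, hb, hb'⟩ := Finset.not_subset.1 h2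
  have l1 := key hw hs ha hb'
  have l2 := key hw' hs' hb ha'
  rw [h] at l1
  exact lt_asymm l1 l2

theorem barycentre_injOn [Fintype V] (K : PreAbstractSimplicialComplex V) :
    Set.InjOn (affineExtension (uniformWeight (V := V)))
      (polyhedron (barycentricSubdivision K)) := by
  classical
  intro w hw w' hw' h
  have hsub := @subset_or_subset_of_barycentre_eq _ _ K
  have hch : IsChain (· ⊆ ·)
      ((Finset.univ.filter fun s => w s ≠ 0 ∨ w' s ≠ 0 : Finset (Finset V)) : Set (Finset V)) := by
    intro s hs t ht _
    simp only [Finset.coe_filter, Finset.mem_univ, true_and, Set.mem_ofPred_eq] at hs ht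
    rcases hs with hs | hs <;> rcases ht with ht | ht
    · exact hsub hw hw rfl hs ht
    · exact hsub hw hw' h hs ht
    · exact hsub hw' hw h.symm hs ht
    · exact hsub hw' hw' rfl hs ht
  have hne : ∀ {w : Finset V → ℝ}, w ∈ polyhedron (barycentricSubdivision K) →
      ∀ s, w s ≠ 0 → s.Nonempty := by
    rintro w ⟨-, c, ⟨-, hcK, -⟩, hwc⟩ s hs
    exact (K.isRelLowerSet_faces (hcK s (hwc s hs))).1
  have hz := sum_indicator_eq_zero hch (fun s hs => by
    rcases (Finset.mem_filter.1 hs).2 with h1 | h1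
    · exact hne hw s h1
    · exact hne hw' s h1) (fun s => w s - w' s) (fun v => by
      rw [Finset.sum_filter_of_ne]
      · have := congrFun h v
        rw [affineExtension_apply, affineExtension_apply, ← sub_eq_zero,
          ← Finset.sum_sub_distrib] at this
        simpa only [sub_mul] using this
      · intro s _ hs
        by_contra! h0
        simp [h0.1, h0.2] at hs)
  funext s
  by_cases hs : w s ≠ 0 ∨ w' s ≠ 0
  · exact sub_eq_zero.1 (hz s (Finset.mem_filter.2 ⟨Finset.mem_univ s, hs⟩))
  · push Not at hs
    rw [hs.1, hs.2]

/-- Greedy argument: subtract the least nonzero coordinate from every coordinate in the support `s`.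
The support shrinks, and the sets used afterwards are all contained in `s`. -/
theorem exists_chain_decomposition [Fintype V] (n : ℕ) (x : V → ℝ) (hx : ∀ v, 0 ≤ x v)
    (hn : (Finset.univ.filter fun v => x v ≠ 0).card = n) :
    ∃ w : Finset V → ℝ, (∀ s, 0 ≤ w s) ∧ (∀ s, w s ≠ 0 → s.Nonempty ∧ ∀ v ∈ s, x v ≠ 0) ∧
      IsChain (· ⊆ ·) {s | w s ≠ 0} ∧ ∀ v, ∑ s, w s * uniformWeight s v = x v := by
  classical
  induction n using Nat.strong_induction_on generalizing x with
  | _ n ih =>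
    set s := Finset.univ.filter fun v => x v ≠ 0 with hs
    have hmem : ∀ v, v ∈ s ↔ x v ≠ 0 := fun v => by simp [hs]
    by_cases h0 : s.Nonempty
    · obtain ⟨a, ha, hmin⟩ := s.exists_min_image x h0
      have hxa : 0 < x a := lt_of_le_of_ne (hx a) ((hmem a).1 ha).symm
      let y : V → ℝ := fun v => x v - if v ∈ s then x a else 0
      have hy : ∀ v, 0 ≤ y v := by
        intro v
        by_cases hv : v ∈ s
        · simpa [y, hv] using hmin v hv
        · simpa [y, hv] using hx v
      have hyx : ∀ v, y v ≠ 0 → v ∈ s := by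
        intro v hv
        by_contra hvs
        have := (hmem v).not.1 hvs
        rw [not_not] at this
        simp [y, hvs, this] at hv
      have hya : y a = 0 := by simp [y, ha]
      have hlt : (Finset.univ.filter fun v => y v ≠ 0).card < n := by
        rw [← hn]
        refine Finset.card_lt_card ⟨fun v hv => hyx v (by simpa using hv), fun h => ?_⟩
        have := h ha
        simp [hya] at this
      obtain ⟨w, hw0, hw1, hw2, hw3⟩ := ih _ hlt y hy rfl
      have hws : w s = 0 := by
        by_contra hne
        exact (hw1 s hne).2 a ha hya
      have hcard : (s.card : ℝ) ≠ 0 := by exact_mod_cast h0.card_pos.ne'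
      -- The barycentre of `s` has coordinates `1 / s.card`, so the weight `s.card * x a` removes
      -- exactly `x a` from each.
      refine ⟨fun t => w t + if t = s then s.card * x a else 0, fun t => ?_, fun t ht => ?_, ?_,
        fun v => ?_⟩
      · have := hw0 t
        dsimp only
        split_ifs <;> positivity
      · by_cases hts : t = s
        · subst hts
          exact ⟨h0, fun v hv => (hmem v).1 hv⟩
        · simp only [hts, if_false, add_zero] at ht
          exact ⟨(hw1 t ht).1, fun v hv => (hmem v).1 (hyx v ((hw1 t ht).2 v hv))⟩
      · have hsubs : ∀ t, w t ≠ 0 → t ⊆ s := fun t ht v hv => hyx v ((hw1 t ht).2 v hv)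
        intro t ht r hr htr
        by_cases hts : t = s
        · by_cases hrs : r = s
          · exact absurd (hts.trans hrs.symm) htr
          · simp only [Set.mem_ofPred_eq, hrs, if_false, add_zero] at hr
            exact Or.inr (hts ▸ hsubs r hr)
        · simp only [Set.mem_ofPred_eq, hts, if_false, add_zero] at ht
          by_cases hrs : r = s
          · exact Or.inl (hrs ▸ hsubs t ht)
          · simp only [Set.mem_ofPred_eq, hrs, if_false, add_zero] at hr
            exact hw2 ht hr htr
      · simp only [add_mul, Finset.sum_add_distrib, hw3, ite_mul, zero_mul,
          Finset.sum_ite_eq', Finset.mem_univ, if_true]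
        by_cases hv : v ∈ s
        · simp only [y, hv, if_true, uniformWeight]
          field_simp
          ring
        · simp [y, hv, uniformWeight]
    · rw [Finset.not_nonempty_iff_eq_empty] at h0
      refine ⟨0, fun _ => le_rfl, fun _ h => absurd rfl h, fun _ h => absurd rfl h, fun v => ?_⟩
      have := (hmem v).not.1 (by simp [h0])
      rw [not_not] at this
      simp [this]

theorem exists_barycentre_eq [Fintype V] {K : PreAbstractSimplicialComplex V} {x : V → ℝ}
    (hx : x ∈ polyhedron K) :
    ∃ w ∈ polyhedron (barycentricSubdivision K), affineExtension uniformWeight w = x := by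
  classical
  obtain ⟨hx, s, hs, hxs⟩ := hx
  obtain ⟨w, hw0, hw1, hw2, hw3⟩ := exists_chain_decomposition _ x hx.1 rfl
  have hsum : ∑ t, w t = 1 := by
    rw [← hx.2]
    simp_rw [← hw3]
    rw [Finset.sum_comm]
    refine Finset.sum_congr rfl fun t _ => ?_
    rw [← Finset.mul_sum]
    by_cases ht : w t = 0
    · simp [ht]
    · rw [(uniformWeight_mem_stdSimplex (hw1 t ht).1).2, mul_one]
  have hwS : w ∈ stdSimplex ℝ (Finset V) := ⟨hw0, hsum⟩
  refine ⟨w, ⟨hwS, Finset.univ.filter fun t => w t ≠ 0, ⟨?_, fun t ht => ?_, ?_⟩, fun t ht => ?_⟩,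
    ?_⟩
  · obtain ⟨t, ht⟩ := exists_ne_zero_of_mem_stdSimplex hwS
    exact ⟨t, by simpa using ht⟩
  · have ht' := hw1 t (Finset.mem_filter.1 ht).2
    exact (K.isRelLowerSet_faces hs).2 (fun v hv => hxs v (ht'.2 v hv)) ht'.1
  · simpa using hw2
  · simpa using ht
  · funext v
    rw [affineExtension_apply, hw3]

end AffineExtension

/-! ### Geometric realisation and subdivision. -/

section Realization

variable {V E : Type*} [Fintype V] [AddCommGroup E] [Module ℝ E]

/-- The geometric simplicial complex with vertices `φ v`. -/
def realization (K : PreAbstractSimplicialComplex V) (φ : V → E)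
    (hφ : Set.InjOn (affineExtension φ) (polyhedron K)) : Geometry.SimplicialComplex ℝ E where
  faces := {t | ∃ s ∈ K.faces, (t : Set E) = φ '' s}
  isRelLowerSet_faces := by
    classical
    rintro t ⟨s, hs, hts⟩
    have hts' : t = s.image φ := Finset.coe_injective (by simpa using hts)
    subst hts'
    refine ⟨(K.isRelLowerSet_faces hs).1.image φ, fun r hr hne => ?_⟩
    obtain ⟨q, hq, rfl⟩ := Finset.subset_image_iff.1 hr
    exact ⟨q, (K.isRelLowerSet_faces hs).2 hq (Finset.image_nonempty.1 hne), by simp⟩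
  indep := by
    classical
    rintro t ⟨s, hs, hts⟩
    by_contra hcon
    -- A Radon point of a dependent vertex set would have two coordinate vectors with disjoint
    -- supports, against the injectivity of the affine extension.
    obtain ⟨I, z, hz1, hz2⟩ := Convex.radon_partition hcon
    have key : ∀ J : Set t, z ∈ convexHull ℝ ((fun e : t => (e : E)) '' J) →
        ∃ x ∈ polyhedron K, affineExtension φ x = z ∧
          ∀ v, x v ≠ 0 → ∃ h : φ v ∈ t, (⟨φ v, h⟩ : t) ∈ J := by
      intro J hJ
      have hJ' : (fun e : t => (e : E)) '' J =
          φ '' {v | v ∈ s ∧ ∃ h : φ v ∈ t, (⟨φ v, h⟩ : t) ∈ J} := by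
        ext e
        constructor
        · rintro ⟨⟨e, he⟩, heJ, rfl⟩
          have he' : e ∈ (t : Set E) := he
          rw [hts] at he'
          obtain ⟨v, hv, rfl⟩ := he'
          exact ⟨v, ⟨hv, he, heJ⟩, rfl⟩
        · rintro ⟨v, ⟨-, h, hJ⟩, rfl⟩
          exact ⟨⟨φ v, h⟩, hJ, rfl⟩
      rw [hJ', mem_convexHull_image_iff] at hJ
      obtain ⟨x, hx, hxs, hxz⟩ := hJ
      exact ⟨x, ⟨hx, s, hs, fun v hv => (hxs v hv).1⟩, hxz, fun v hv => (hxs v hv).2⟩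
    obtain ⟨x, hx, hxz, hxI⟩ := key _ hz1
    obtain ⟨y, hy, hyz, hyI⟩ := key _ hz2
    obtain rfl := hφ hx hy (hxz.trans hyz.symm)
    obtain ⟨v, hv⟩ := exists_ne_zero_of_mem_stdSimplex hx.1
    obtain ⟨_, h1⟩ := hxI v hv
    obtain ⟨_, h2⟩ := hyI v hv
    exact h2 h1
  inter_subset_convexHull := by
    rintro t t' ⟨s, hs, hts⟩ ⟨s', hs', hts'⟩ z ⟨hz, hz'⟩
    rw [hts, mem_convexHull_image_iff] at hz
    rw [hts', mem_convexHull_image_iff] at hz'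
    obtain ⟨x, hx, hxs, rfl⟩ := hz
    obtain ⟨y, hy, hys, hyz⟩ := hz'
    obtain rfl := hφ ⟨hy, s', hs', hys⟩ ⟨hx, s, hs, hxs⟩ hyz
    refine convexHull_mono (s := φ '' ((s : Set V) ∩ s')) ?_
      ((mem_convexHull_image_iff _ _ _).2 ⟨y, hx, fun v hv => ⟨hxs v hv, hys v hv⟩, rfl⟩)
    rw [hts, hts']
    exact Set.image_inter_subset _ _ _

theorem sum_coe_eq_sum {F : Type*} [AddCommMonoid F] {s : Finset V} (f : V → F)
    (hf : ∀ v, v ∉ s → f v = 0) : ∑ v : s, f v = ∑ v, f v := by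
  rw [Finset.sum_coe_sort s f]
  exact Finset.sum_subset (Finset.subset_univ _) fun v _ hv => hf v hv

/-- Within one simplex this is affine independence. If the two coordinate vectors live on `s` and
`t`, their common image lies in the hull of the common vertices, so it has a third coordinate vector
supported in both; that vector equals each of the other two. -/
theorem injOn_affineExtension_of_simplicialComplex (L : Geometry.SimplicialComplex ℝ E)
    (K : PreAbstractSimplicialComplex V) (φ : V → E) (hφ : Function.Injective φ)
    (hK : ∀ s ∈ K.faces, s.map ⟨φ, hφ⟩ ∈ L.faces) :
    Set.InjOn (affineExtension φ) (polyhedron K) := by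
  classical
  have uniq : ∀ s ∈ K.faces, ∀ x y : V → ℝ, x ∈ stdSimplex ℝ V → y ∈ stdSimplex ℝ V →
      (∀ v, x v ≠ 0 → v ∈ s) → (∀ v, y v ≠ 0 → v ∈ s) →
      affineExtension φ x = affineExtension φ y → x = y := by
    intro s hs x y hx hy hxs hys hxy
    have hind := L.indep (hK s hs)
    let e : s ↪ (s.map ⟨φ, hφ⟩ : Finset E) :=
      ⟨fun v => ⟨φ v, Finset.mem_map_of_mem ⟨φ, hφ⟩ v.2⟩, fun a b h =>
        Subtype.ext (hφ (congrArg Subtype.val h))⟩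
    have hind' : AffineIndependent ℝ (fun v : s => φ v) := hind.comp_embedding e
    rw [affineIndependent_iff] at hind'
    have hzero : ∀ v, v ∉ s → x v - y v = 0 := by
      intro v hv
      have h1 : x v = 0 := by_contra fun h => hv (hxs v h)
      have h2 : y v = 0 := by_contra fun h => hv (hys v h)
      rw [h1, h2, sub_zero]
    have := hind' Finset.univ (fun v => x v - y v)
      (by
        rw [sum_coe_eq_sum (fun v => x v - y v) hzero, Finset.sum_sub_distrib, hx.2, hy.2, sub_self])
      (by
        rw [sum_coe_eq_sum (fun v => (x v - y v) • φ v) fun v hv => by rw [hzero v hv, zero_smul]]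
        simp only [sub_smul, Finset.sum_sub_distrib]
        exact sub_eq_zero.2 hxy)
    funext v
    by_cases hv : v ∈ s
    · exact sub_eq_zero.1 (this ⟨v, hv⟩ (Finset.mem_univ _))
    · exact sub_eq_zero.1 (hzero v hv)
  rintro x ⟨hx, s, hs, hxs⟩ y ⟨hy, t, ht, hyt⟩ hxy
  have h1 : affineExtension φ x ∈ convexHull ℝ ((s.map ⟨φ, hφ⟩ : Finset E) : Set E) := by
    rw [Finset.coe_map]
    exact (mem_convexHull_image_iff _ _ _).2 ⟨x, hx, hxs, rfl⟩
  have h2 : affineExtension φ x ∈ convexHull ℝ ((t.map ⟨φ, hφ⟩ : Finset E) : Set E) := by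
    rw [Finset.coe_map]
    exact (mem_convexHull_image_iff _ _ _).2 ⟨y, hy, hyt, hxy.symm⟩
  have h3 := L.inter_subset_convexHull (hK s hs) (hK t ht) ⟨h1, h2⟩
  rw [Finset.coe_map, Finset.coe_map, ← Set.image_inter (by exact hφ)] at h3
  obtain ⟨z, hz, hzs, hzx⟩ := (mem_convexHull_image_iff _ _ _).1 h3
  rw [uniq s hs x z hx hz hxs (fun v hv => (hzs v hv).1) hzx.symm,
    uniq t ht y z hy hz hyt (fun v hv => (hzs v hv).2) (hxy.symm.trans hzx.symm)]

theorem realization_space (K : PreAbstractSimplicialComplex V) (φ : V → E)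
    (hφ : Set.InjOn (affineExtension φ) (polyhedron K)) :
    (realization K φ hφ).space = affineExtension φ '' polyhedron K := by
  classical
  ext z
  rw [Geometry.SimplicialComplex.mem_space_iff]
  constructor
  · rintro ⟨t, ⟨s, hs, hts⟩, hz⟩
    rw [hts, mem_convexHull_image_iff] at hz
    obtain ⟨x, hx, hxs, rfl⟩ := hz
    exact ⟨x, ⟨hx, s, hs, hxs⟩, rfl⟩
  · rintro ⟨x, ⟨hx, s, hs, hxs⟩, rfl⟩
    refine ⟨s.image φ, ⟨s, hs, by simp⟩, ?_⟩
    rw [Finset.coe_image]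
    exact (mem_convexHull_image_iff _ _ _).2 ⟨x, hx, hxs, rfl⟩

theorem IsSubdivision.trans {L₁ L₂ L₃ : Geometry.SimplicialComplex ℝ E}
    (h₁ : IsSubdivision L₁ L₂) (h₂ : IsSubdivision L₂ L₃) : IsSubdivision L₁ L₃ where
  subset_simplex s hs := by
    obtain ⟨t, ht, hst⟩ := h₁.subset_simplex s hs
    obtain ⟨r, hr, htr⟩ := h₂.subset_simplex t ht
    exact ⟨r, hr, hst.trans htr⟩
  eq_union t ht := by
    obtain ⟨F, hF, hFL, hFt⟩ := h₂.eq_union t ht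
    have hex : ∀ s : Finset E, ∃ F' : Set (Finset E), s ∈ F → F'.Finite ∧ F' ⊆ L₁.faces ∧
        closedSimplex s = ⋃ r ∈ F', closedSimplex r := by
      intro s
      by_cases hs : s ∈ F
      · obtain ⟨F', h⟩ := h₁.eq_union s (hFL hs)
        exact ⟨F', fun _ => h⟩
      · exact ⟨∅, fun h => absurd h hs⟩
    choose F' hF' using hex
    refine ⟨⋃ s ∈ F, F' s, hF.biUnion fun s hs => (hF' s hs).1,
      Set.iUnion₂_subset fun s hs => (hF' s hs).2.1, ?_⟩
    rw [hFt]
    simp only [Set.biUnion_iUnion]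
    exact Set.iUnion₂_congr fun s hs => (hF' s hs).2.2

theorem injOn_barycentricSubdivision {K : PreAbstractSimplicialComplex V} {φ : V → E}
    (hφ : Set.InjOn (affineExtension φ) (polyhedron K)) :
    Set.InjOn (affineExtension fun s => affineExtension φ (uniformWeight s))
      (polyhedron (barycentricSubdivision K)) := by
  intro w hw w' hw' h
  rw [← affineExtension_comp, ← affineExtension_comp] at h
  exact barycentre_injOn K hw hw' (hφ (barycentre_mem_polyhedron hw)
    (barycentre_mem_polyhedron hw') h)

/-- A chain of simplices spans a simplex inside its largest member, and every point of a simplex is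
a barycentric combination along a chain of its faces. -/
theorem isSubdivision_barycentricSubdivision {K : PreAbstractSimplicialComplex V} {φ : V → E}
    (hφ : Set.InjOn (affineExtension φ) (polyhedron K)) :
    IsSubdivision (realization (barycentricSubdivision K)
      (fun s => affineExtension φ (uniformWeight s)) (injOn_barycentricSubdivision hφ))
      (realization K φ hφ) := by
  classical
  have sub : ∀ c ∈ (barycentricSubdivision K).faces, ∀ s : Finset V, (∀ t ∈ c, t ⊆ s) →
      convexHull ℝ ((fun s => affineExtension φ (uniformWeight s)) '' (c : Set (Finset V))) ⊆
        convexHull ℝ (φ '' s) := by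
    intro c hc s hs z hz
    obtain ⟨w, hw, hwc, rfl⟩ := (mem_convexHull_image_iff _ _ _).1 hz
    rw [← affineExtension_comp]
    refine (mem_convexHull_image_iff _ _ _).2 ⟨_, (barycentre_mem_polyhedron
      ⟨hw, c, hc, hwc⟩).1, fun v hv => ?_, rfl⟩
    obtain ⟨t, ht, htv⟩ := (affineExtension_ne_zero_iff hw uniformWeight_nonneg v).1 hv
    exact hs t (hwc t ht) ((uniformWeight_ne_zero_iff t v).1 htv)
  constructor
  · rintro r ⟨c, hc, hr⟩
    obtain ⟨s, hs, hmax⟩ := exists_max_of_chain hc.1 hc.2.2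
    refine ⟨s.image φ, ⟨s, hc.2.1 s hs, by simp⟩, ?_⟩
    rw [closedSimplex, closedSimplex, hr, Finset.coe_image]
    exact sub c hc s hmax
  · rintro t ⟨s, hs, ht⟩
    refine ⟨(fun c : Finset (Finset V) => c.image fun s => affineExtension φ (uniformWeight s)) ''
      {c | c ∈ (barycentricSubdivision K).faces ∧ ∀ r ∈ c, r ⊆ s}, (Set.toFinite _).image _, ?_, ?_⟩
    · rintro _ ⟨c, hc, rfl⟩
      exact ⟨c, hc.1, by simp⟩
    · apply Set.Subset.antisymm
      · intro z hz
        rw [closedSimplex, ht] at hz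
        obtain ⟨x, hx, hxs, rfl⟩ := (mem_convexHull_image_iff _ _ _).1 hz
        obtain ⟨w, ⟨hw, c, hc, hwc⟩, rfl⟩ := exists_barycentre_eq (K := K) ⟨hx, s, hs, hxs⟩
        have hsupp : ∀ r, w r ≠ 0 → r ⊆ s := fun r hr v hv =>
          hxs v ((affineExtension_ne_zero_iff hw uniformWeight_nonneg v).2
            ⟨r, hr, (uniformWeight_ne_zero_iff r v).2 hv⟩)
        -- The support of `w` replaces `c`, since `c` may have members outside `s` that carry no
        -- weight.
        refine Set.mem_biUnion (x := (Finset.univ.filter fun r => w r ≠ 0).image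
          fun s => affineExtension φ (uniformWeight s)) ⟨_, ⟨(barycentricSubdivision
            K).isRelLowerSet_faces hc |>.2 (fun r hr => hwc r (by simpa using hr)) ?_,
            fun r hr => hsupp r (by simpa using hr)⟩, rfl⟩ ?_
        · obtain ⟨r, hr⟩ := exists_ne_zero_of_mem_stdSimplex hw
          exact ⟨r, by simpa using hr⟩
        · rw [affineExtension_comp]
          exact (mem_closedSimplex_image_iff _ _ _).2 ⟨w, hw, fun r hr => by simpa using hr, rfl⟩
      · refine Set.iUnion₂_subset ?_
        rintro _ ⟨c, hc, rfl⟩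
        rw [closedSimplex, closedSimplex, Finset.coe_image, ht]
        exact sub c hc.1 s hc.2

end Realization

end SimplicialOrbit

/-! ### Graph chains, potentials and the covering complex. -/

namespace HomologyCover

open Finset

section EdgeChains

variable {ι : Type*} [LinearOrder ι] (R : Type*) [CommRing R]

/-- The oriented edge from `a` to `b`, as a simplicial one-chain on the complete graph. -/
noncomputable def edge (a b : ι) : ι × ι →₀ R :=
  if a < b then Finsupp.single (a, b) 1 else if b < a then -Finsupp.single (b, a) 1 else 0

@[simp]
theorem edge_self (a : ι) : edge R a a = 0 := by simp [edge]

theorem edge_symm (a b : ι) : edge R a b = -edge R b a := by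
  rcases lt_trichotomy a b with h | rfl | h
  · simp [edge, h, h.not_gt]
  · simp
  · simp [edge, h, h.not_gt]

/-- The boundary of an oriented triangle. -/
noncomputable def triangle (a b c : ι) : ι × ι →₀ R := edge R a b + edge R b c + edge R c a

/-- The span of the boundaries of the triangles with vertices in `σ`. These are the simplicial
one-cycles of the complete graph on `σ`. -/
noncomputable def triangles (σ : Finset ι) : Submodule R (ι × ι →₀ R) :=
  Submodule.span R {t | ∃ a ∈ σ, ∃ b ∈ σ, ∃ c ∈ σ, t = triangle R a b c}

variable {R}

theorem edge_mem_span {σ : Finset ι} {a b : ι} (ha : a ∈ σ) (hb : b ∈ σ) :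
    edge R a b ∈ Submodule.span R {e | ∃ x ∈ σ, ∃ y ∈ σ, x < y ∧ e = Finsupp.single (x, y) (1 : R)} := by
  rcases lt_trichotomy a b with h | rfl | h
  · rw [edge, if_pos h]
    exact Submodule.subset_span ⟨a, ha, b, hb, h, rfl⟩
  · rw [edge_self]
    exact zero_mem _
  · rw [edge, if_neg h.not_gt, if_pos h]
    exact neg_mem (Submodule.subset_span ⟨b, hb, a, ha, h, rfl⟩)

theorem triangle_mem {σ : Finset ι} {a b c : ι} (ha : a ∈ σ) (hb : b ∈ σ) (hc : c ∈ σ) :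
    triangle R a b c ∈ triangles R σ :=
  Submodule.subset_span ⟨a, ha, b, hb, c, hc, rfl⟩

theorem triangles_mono {σ τ : Finset ι} (h : σ ⊆ τ) : triangles R σ ≤ triangles R τ :=
  Submodule.span_mono fun _ ⟨a, ha, b, hb, c, hc, e⟩ => ⟨a, h ha, b, h hb, c, h hc, e⟩

/-- A single edge carries no cycle, so over an edge of the complex the difference of a potential is
forced. -/
theorem triangles_pair (a b : ι) : triangles R {a, b} = ⊥ := by
  rw [triangles, Submodule.span_eq_bot]
  rintro _ ⟨x, hx, y, hy, z, hz, rfl⟩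
  simp only [mem_insert, mem_singleton] at hx hy hz
  have h := edge_symm R a b
  rcases hx with hx | hx <;> rcases hy with hy | hy <;> rcases hz with hz | hz <;>
    simp [triangle, hx, hy, hz, h]

end EdgeChains

section StepPotential

variable {ι : Type*} [LinearOrder ι] {R : Type*} [CommRing R] {σ ρ : Finset ι}

/-- The potential with difference `w` between `σ` and the other simplices. -/
noncomputable def stepPotential (σ : Finset ι) (w : ι × ι →₀ R) (ρ : Finset ι) : ι × ι →₀ R :=
  if ρ = σ then w else 0

@[simp]
theorem stepPotential_self (σ : Finset ι) (w : ι × ι →₀ R) : stepPotential σ w σ = w := if_pos rfl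

theorem stepPotential_of_ne (h : ρ ≠ σ) (w : ι × ι →₀ R) : stepPotential σ w ρ = 0 := if_neg h

end StepPotential

section Base

variable {ι : Type*} [Nonempty ι]

/-- A chosen vertex of a simplex. -/
noncomputable def base (σ : Finset ι) : ι :=
  open Classical in if h : σ.Nonempty then h.choose else Classical.arbitrary ι

theorem base_mem {σ : Finset ι} (h : σ.Nonempty) : base σ ∈ σ := by
  rw [base, dif_pos h]
  exact h.choose_spec

@[simp]
theorem base_singleton (a : ι) : base {a} = a :=
  mem_singleton.1 (base_mem (singleton_nonempty a))

end Base

variable {ι : Type*} [LinearOrder ι] [Nonempty ι] (R : Type*) [CommRing R]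
  (K : PreAbstractSimplicialComplex ι)

/-- A potential on a chain `C` of simplices, whose differences are paths of edges between the base
vertices. -/
structure IsPotential (C : Finset (Finset ι)) (u : Finset ι → ι × ι →₀ R) : Prop where
  nonempty : C.Nonempty
  faces : ∀ σ ∈ C, σ ∈ K.faces
  total : ∀ σ ∈ C, ∀ τ ∈ C, σ ⊆ τ ∨ τ ⊆ σ
  sub_sub_mem : ∀ σ ∈ C, ∀ τ ∈ C, τ ⊆ σ → u σ - u τ - edge R (base σ) (base τ) ∈ triangles R σ

/-- The vertices of the covering complex: a chain of simplices together with a potential on it, up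
to an additive constant. The potential is recorded by its differences. -/
def CoverVertex : Type _ :=
  {x : Finset (Finset ι) × (Finset ι → Finset ι → ι × ι →₀ R) //
    ∃ u, IsPotential R K x.1 u ∧
      ∀ σ τ, x.2 σ τ = open Classical in if σ ∈ x.1 ∧ τ ∈ x.1 then u σ - u τ else 0}

variable {R K}

namespace CoverVertex

/-- The chain of simplices under a vertex of the covering complex. -/
def chain (x : CoverVertex R K) : Finset (Finset ι) := x.1.1

/-- The differences of the potential. -/
def diff (x : CoverVertex R K) : Finset ι → Finset ι → ι × ι →₀ R := x.1.2

theorem exists_potential (x : CoverVertex R K) :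
    ∃ u, IsPotential R K x.chain u ∧
      ∀ σ ∈ x.chain, ∀ τ ∈ x.chain, x.diff σ τ = u σ - u τ := by
  obtain ⟨u, hu, h⟩ := x.2
  refine ⟨u, hu, fun σ hσ τ hτ => (h σ τ).trans (if_pos ⟨hσ, hτ⟩)⟩

theorem chain_nonempty (x : CoverVertex R K) : x.chain.Nonempty :=
  x.exists_potential.choose_spec.1.nonempty

theorem diff_eq_zero (x : CoverVertex R K) {σ τ : Finset ι} (h : ¬(σ ∈ x.chain ∧ τ ∈ x.chain)) :
    x.diff σ τ = 0 := by
  obtain ⟨u, -, hu⟩ := x.2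
  exact (hu σ τ).trans (if_neg h)

theorem ext {x y : CoverVertex R K} (h : x.chain = y.chain)
    (hd : ∀ σ ∈ x.chain, ∀ τ ∈ x.chain, x.diff σ τ = y.diff σ τ) : x = y := by
  refine Subtype.ext (Prod.ext h (funext fun σ => funext fun τ => ?_))
  by_cases hστ : σ ∈ x.chain ∧ τ ∈ x.chain
  · exact hd σ hστ.1 τ hστ.2
  · exact (x.diff_eq_zero hστ).trans (y.diff_eq_zero (h ▸ hστ)).symm

theorem diff_add (x : CoverVertex R K) {σ τ ρ : Finset ι} (hσ : σ ∈ x.chain) (hτ : τ ∈ x.chain)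
    (hρ : ρ ∈ x.chain) : x.diff σ τ + x.diff τ ρ = x.diff σ ρ := by
  obtain ⟨u, -, hu⟩ := x.exists_potential
  rw [hu σ hσ τ hτ, hu τ hτ ρ hρ, hu σ hσ ρ hρ]
  abel

/-- The vertex of the covering complex given by a potential. -/
noncomputable def mk (C : Finset (Finset ι)) (u : Finset ι → ι × ι →₀ R)
    (h : IsPotential R K C u) : CoverVertex R K :=
  ⟨(C, fun σ τ => open Classical in if σ ∈ C ∧ τ ∈ C then u σ - u τ else 0), u, h, fun _ _ => rfl⟩

@[simp]
theorem chain_mk (C : Finset (Finset ι)) (u : Finset ι → ι × ι →₀ R) (h : IsPotential R K C u) :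
    (mk C u h).chain = C := rfl

theorem diff_mk {C : Finset (Finset ι)} {u : Finset ι → ι × ι →₀ R} (h : IsPotential R K C u)
    {σ τ : Finset ι} (hσ : σ ∈ C) (hτ : τ ∈ C) : (mk C u h).diff σ τ = u σ - u τ :=
  if_pos ⟨hσ, hτ⟩

instance : PartialOrder (CoverVertex R K) where
  le x y := x.chain ⊆ y.chain ∧ ∀ σ ∈ x.chain, ∀ τ ∈ x.chain, x.diff σ τ = y.diff σ τ
  le_refl x := ⟨Subset.rfl, fun _ _ _ _ => rfl⟩
  le_trans x y z h h' := ⟨h.1.trans h'.1, fun σ hσ τ hτ =>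
    (h.2 σ hσ τ hτ).trans (h'.2 σ (h.1 hσ) τ (h.1 hτ))⟩
  le_antisymm x y h h' := ext (h.1.antisymm h'.1) h.2

theorem le_iff {x y : CoverVertex R K} : x ≤ y ↔
    x.chain ⊆ y.chain ∧ ∀ σ ∈ x.chain, ∀ τ ∈ x.chain, x.diff σ τ = y.diff σ τ := Iff.rfl

end CoverVertex

open CoverVertex

theorem IsPotential.mono {C C' : Finset (Finset ι)} {u : Finset ι → ι × ι →₀ R}
    (h : IsPotential R K C u) (hC : C' ⊆ C) (hne : C'.Nonempty) : IsPotential R K C' u where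
  nonempty := hne
  faces σ hσ := h.faces σ (hC hσ)
  total σ hσ τ hτ := h.total σ (hC hσ) τ (hC hτ)
  sub_sub_mem σ hσ τ hτ := h.sub_sub_mem σ (hC hσ) τ (hC hτ)

theorem IsPotential.congr {C : Finset (Finset ι)} {u u' : Finset ι → ι × ι →₀ R}
    (h : IsPotential R K C u) (hu : ∀ σ ∈ C, ∀ τ ∈ C, u' σ - u' τ = u σ - u τ) :
    IsPotential R K C u' where
  nonempty := h.nonempty
  faces := h.faces
  total := h.total
  sub_sub_mem σ hσ τ hτ hστ := hu σ hσ τ hτ ▸ h.sub_sub_mem σ hσ τ hτ hστ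

/-! ### The group action on the cover. -/

section Action

/-- The group acting on the covering complex. -/
abbrev DeckGroup (ι : Type*) [LinearOrder ι] (R : Type*) [CommRing R] : Type _ :=
  (σ : Finset ι) → triangles R σ

theorem IsPotential.vadd {C : Finset (Finset ι)} {u : Finset ι → ι × ι →₀ R}
    (h : IsPotential R K C u) (g : DeckGroup ι R) :
    IsPotential R K C fun σ => u σ + g σ where
  nonempty := h.nonempty
  faces := h.faces
  total := h.total
  sub_sub_mem σ hσ τ hτ hστ := by
    have e : u σ + g σ - (u τ + g τ) - edge R (base σ) (base τ) =
        (u σ - u τ - edge R (base σ) (base τ)) + (g σ - g τ : ι × ι →₀ R) := by abel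
    rw [e]
    exact add_mem (h.sub_sub_mem σ hσ τ hτ hστ) (sub_mem (g σ).2 (triangles_mono hστ (g τ).2))

open Classical in
noncomputable instance : VAdd (DeckGroup ι R) (CoverVertex R K) where
  vadd g x := ⟨(x.chain, fun σ τ => if σ ∈ x.chain ∧ τ ∈ x.chain then
    x.diff σ τ + ((g σ : ι × ι →₀ R) - g τ) else 0), by
      obtain ⟨u, hu, h⟩ := x.exists_potential
      refine ⟨_, hu.vadd g, fun σ τ => ?_⟩
      by_cases hστ : σ ∈ x.chain ∧ τ ∈ x.chain
      · simp only [hστ, h σ hστ.1 τ hστ.2, and_self, if_true]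
        abel
      · simp only [hστ, if_false]⟩

@[simp]
theorem chain_vadd (g : DeckGroup ι R) (x : CoverVertex R K) : (g +ᵥ x).chain = x.chain := rfl

theorem diff_vadd (g : DeckGroup ι R) (x : CoverVertex R K) {σ τ : Finset ι} (hσ : σ ∈ x.chain)
    (hτ : τ ∈ x.chain) : (g +ᵥ x).diff σ τ = x.diff σ τ + ((g σ : ι × ι →₀ R) - g τ) :=
  if_pos ⟨hσ, hτ⟩

noncomputable instance : AddAction (DeckGroup ι R) (CoverVertex R K) where
  zero_vadd x := CoverVertex.ext rfl fun σ hσ τ hτ => by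
    rw [chain_vadd] at hσ hτ
    rw [diff_vadd _ _ hσ hτ, Pi.zero_apply, Pi.zero_apply, ZeroMemClass.coe_zero,
      ZeroMemClass.coe_zero, sub_zero, add_zero]
  add_vadd g h x := CoverVertex.ext rfl fun σ hσ τ hτ => by
    rw [chain_vadd] at hσ hτ
    have e : ∀ ρ, ((g + h) ρ : ι × ι →₀ R) = g ρ + h ρ := fun _ => rfl
    rw [diff_vadd _ _ hσ hτ, diff_vadd g (h +ᵥ x) hσ hτ, diff_vadd h x hσ hτ, e, e]
    generalize x.diff σ τ = d, (g σ : ι × ι →₀ R) = a, (g τ : ι × ι →₀ R) = b,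
      (h σ : ι × ι →₀ R) = a', (h τ : ι × ι →₀ R) = b'
    abel

theorem vadd_le_vadd (g : DeckGroup ι R) {x y : CoverVertex R K} (h : x ≤ y) :
    g +ᵥ x ≤ g +ᵥ y :=
  ⟨h.1, fun σ hσ τ hτ => by
    rw [diff_vadd g x hσ hτ, diff_vadd g y (h.1 hσ) (h.1 hτ), h.2 σ hσ τ hτ]⟩

/-- Only differences matter, so both potentials may be normalised at the smallest simplex `ρ` of the
chain. Their values at `σ` then lie in the same coset of `triangles σ`, and the difference of these
values is the required group element. -/
theorem exists_vadd_eq (x y : CoverVertex R K) (h : x.chain = y.chain) :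
    ∃ g : DeckGroup ι R, g +ᵥ x = y := by
  classical
  obtain ⟨u, hu, hx⟩ := x.exists_potential
  obtain ⟨u', hu', hy⟩ := y.exists_potential
  obtain ⟨ρ, hρ, hmin⟩ : ∃ ρ ∈ x.chain, ∀ σ ∈ x.chain, ρ ⊆ σ := by
    obtain ⟨ρ, hρ, hmin⟩ := x.chain.exists_minimal x.chain_nonempty
    refine ⟨ρ, hρ, fun σ hσ => (hu.total ρ hρ σ hσ).elim id fun hs => hmin hσ hs⟩
  refine ⟨fun σ => if hσ : σ ∈ x.chain then
    ⟨(u' σ - u' ρ - edge R (base σ) (base ρ)) - (u σ - u ρ - edge R (base σ) (base ρ)),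
      sub_mem (hu'.sub_sub_mem σ (h ▸ hσ) ρ (h ▸ hρ) (hmin σ hσ))
        (hu.sub_sub_mem σ hσ ρ hρ (hmin σ hσ))⟩ else 0, CoverVertex.ext h fun σ hσ τ hτ => ?_⟩
  rw [chain_vadd] at hσ hτ
  rw [diff_vadd _ _ hσ hτ, hx σ hσ τ hτ, hy σ (h ▸ hσ) τ (h ▸ hτ), dif_pos hσ, dif_pos hτ]
  dsimp only
  abel

theorem exists_le_of_chain_subset (x : CoverVertex R K) {C : Finset (Finset ι)}
    (hC : C ⊆ x.chain) (hne : C.Nonempty) : ∃ y ≤ x, y.chain = C := by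
  obtain ⟨u, hu, hx⟩ := x.exists_potential
  exact ⟨mk C u (hu.mono hC hne), ⟨hC, fun σ hσ τ hτ => by
    rw [chain_mk] at hσ hτ
    rw [diff_mk _ hσ hτ, hx σ (hC hσ) τ (hC hτ)]⟩, rfl⟩

/-- The vertices below `z` are the restrictions of its potential. Hence the projection is injective
on simplices, and a group element that is right at the top vertex of a simplex is right on all of
it. -/
theorem eq_of_le_of_le {x y z : CoverVertex R K} (hx : x ≤ z) (hy : y ≤ z)
    (h : x.chain = y.chain) : x = y :=
  CoverVertex.ext h fun σ hσ τ hτ =>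
    (hx.2 σ hσ τ hτ).trans (hy.2 σ (h ▸ hσ) τ (h ▸ hτ)).symm

end Action

variable (R) in
/-- The potential that vanishes at the vertex `a`. -/
noncomputable def starPotential (a : ι) (σ : Finset ι) : ι × ι →₀ R := edge R (base σ) a

theorem isPotential_starPotential {C : Finset (Finset ι)} (h0 : C.Nonempty)
    (hK : ∀ σ ∈ C, σ ∈ K.faces) (hC : ∀ σ ∈ C, ∀ τ ∈ C, σ ⊆ τ ∨ τ ⊆ σ) {a : ι}
    (ha : ∀ σ ∈ C, a ∈ σ) : IsPotential R K C (starPotential R a) where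
  nonempty := h0
  faces := hK
  total := hC
  sub_sub_mem σ hσ τ hτ hστ := by
    have e : starPotential R a σ - starPotential R a τ - edge R (base σ) (base τ) =
        triangle R (base σ) a (base τ) := by
      rw [starPotential, starPotential, triangle, edge_symm R a, edge_symm R (base τ) (base σ)]
      abel
    rw [e]
    exact triangle_mem (base_mem ⟨a, ha σ hσ⟩) (ha σ hσ) (hστ (base_mem ⟨a, ha τ hτ⟩))

/-- A vertex `a` of the smallest simplex lies in all the others, so the star potential at `a` is
available. -/
theorem exists_coverVertex {C : Finset (Finset ι)}
    (hC : C ∈ (SimplicialOrbit.barycentricSubdivision K).faces) :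
    ∃ x : CoverVertex R K, x.chain = C := by
  obtain ⟨h0, hK, hch⟩ := hC
  obtain ⟨ρ, hρ, hmin⟩ : ∃ ρ ∈ C, ∀ σ ∈ C, ρ ⊆ σ := by
    obtain ⟨ρ, hρ, hmin⟩ := C.exists_minimal h0
    refine ⟨ρ, hρ, fun σ hσ => (hch.total hρ hσ).elim id fun hs => hmin hσ hs⟩
  obtain ⟨a, ha⟩ := (K.isRelLowerSet_faces (hK ρ hρ)).1
  exact ⟨mk C _ (isPotential_starPotential h0 hK (fun σ hσ τ hτ => hch.total hσ hτ)
    fun σ hσ => hmin σ hσ ha), rfl⟩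

theorem chain_mem_faces (x : CoverVertex R K) :
    x.chain ∈ (SimplicialOrbit.barycentricSubdivision K).faces := by
  obtain ⟨u, hu, -⟩ := x.exists_potential
  exact ⟨hu.nonempty, hu.faces, fun σ hσ τ hτ _ => hu.total σ hσ τ hτ⟩

theorem isPotential_singleton {σ : Finset ι} (hσ : σ ∈ K.faces) : IsPotential R K {σ} 0 where
  nonempty := singleton_nonempty σ
  faces τ hτ := mem_singleton.1 hτ ▸ hσ
  total τ hτ ρ hρ := by
    rw [mem_singleton.1 hτ, mem_singleton.1 hρ]
    exact Or.inl Subset.rfl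
  sub_sub_mem τ hτ ρ hρ _ := by
    rw [mem_singleton.1 hτ, mem_singleton.1 hρ]
    simp

theorem isPotential_star_pair {a : ι} {σ : Finset ι} (hσ : σ ∈ K.faces) (ha : a ∈ σ) :
    IsPotential R K {{a}, σ} (starPotential R a) := by
  have haσ : {a} ⊆ σ := singleton_subset_iff.2 ha
  refine isPotential_starPotential (by simp) ?_ ?_ ?_
  · simp only [mem_insert, mem_singleton, forall_eq_or_imp, forall_eq]
    exact ⟨(K.isRelLowerSet_faces hσ).2 haσ (singleton_nonempty a), hσ⟩
  · simp only [mem_insert, mem_singleton, forall_eq_or_imp, forall_eq]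
    exact ⟨⟨Or.inl Subset.rfl, Or.inl haσ⟩, Or.inr haσ, Or.inl Subset.rfl⟩
  · simp [ha]

section Step

variable {C C' : Finset (Finset ι)} {u u' : Finset ι → ι × ι →₀ R} {σ τ ρ : Finset ι}

theorem isPotential_step {w : ι × ι →₀ R} (hσ : σ ∈ K.faces) (hτ : τ.Nonempty) (hτσ : τ ⊂ σ)
    (hw : w - edge R (base σ) (base τ) ∈ triangles R σ) :
    IsPotential R K {τ, σ} (stepPotential σ w) := by
  have hne : τ ≠ σ := hτσ.ne
  refine ⟨by simp, ?_, ?_, ?_⟩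
  · simp only [mem_insert, mem_singleton, forall_eq_or_imp, forall_eq]
    exact ⟨(K.isRelLowerSet_faces hσ).2 hτσ.1 hτ, hσ⟩
  · simp only [mem_insert, mem_singleton, forall_eq_or_imp, forall_eq]
    exact ⟨⟨Or.inl Subset.rfl, Or.inl hτσ.1⟩, Or.inr hτσ.1, Or.inl Subset.rfl⟩
  · simp only [mem_insert, mem_singleton, forall_eq_or_imp, forall_eq, sub_self, edge_self,
      zero_mem, implies_true, stepPotential_self, stepPotential_of_ne hne, sub_zero, hw, true_and,
      and_true]
    exact fun h => absurd h hτσ.2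

/-- The step from the smallest simplex `ρ` down to the new face `τ` is declared to be the bare edge
between base vertices. Relative to a larger `σ` this costs one triangle with vertices in `σ`, which
is allowed. -/
theorem isPotential_insert (h : IsPotential R K C u) (hρ : ρ ∈ C) (hmin : ∀ τ ∈ C, ρ ⊆ τ)
    (hτ : τ.Nonempty) (hτρ : τ ⊆ ρ) (hτC : τ ∉ C) :
    IsPotential R K (insert τ C)
      (Function.update u τ (u ρ - edge R (base ρ) (base τ))) := by
  have hsub : ∀ σ ∈ C, τ ⊆ σ := fun σ hσ => hτρ.trans (hmin σ hσ)
  have hupd : ∀ σ ∈ C, Function.update u τ (u ρ - edge R (base ρ) (base τ)) σ = u σ :=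
    fun σ hσ => Function.update_of_ne (fun e : σ = τ => hτC (e ▸ hσ)) _ _
  refine ⟨by simp, ?_, ?_, ?_⟩
  · simp only [mem_insert, forall_eq_or_imp]
    exact ⟨(K.isRelLowerSet_faces (h.faces ρ hρ)).2 hτρ hτ, h.faces⟩
  · simp only [mem_insert, forall_eq_or_imp]
    exact ⟨⟨Or.inl Subset.rfl, fun σ hσ => Or.inl (hsub σ hσ)⟩,
      fun σ hσ => ⟨Or.inr (hsub σ hσ), h.total σ hσ⟩⟩
  · simp only [mem_insert, forall_eq_or_imp]
    refine ⟨⟨fun _ => by simp, fun σ hσ hστ => absurd ?_ hτC⟩, fun σ hσ => ⟨fun _ => ?_,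
      fun τ' hτ' => ?_⟩⟩
    · exact (hστ.antisymm (hsub σ hσ)) ▸ hσ
    · rw [hupd σ hσ, Function.update_self]
      have e : u σ - (u ρ - edge R (base ρ) (base τ)) - edge R (base σ) (base τ) =
          (u σ - u ρ - edge R (base σ) (base ρ)) +
            triangle R (base σ) (base ρ) (base τ) := by
        rw [triangle, edge_symm R (base τ) (base σ)]
        abel
      rw [e]
      have hb : base ρ ∈ σ := hmin σ hσ (base_mem (K.isRelLowerSet_faces (h.faces ρ hρ)).1)
      exact add_mem (h.sub_sub_mem σ hσ ρ hρ (hmin σ hσ))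
        (triangle_mem (base_mem ⟨_, hb⟩) hb (hsub σ hσ (base_mem hτ)))
    · rw [hupd σ hσ, hupd τ' hτ']
      exact h.sub_sub_mem σ hσ τ' hτ'

end Step

variable (R K) in
/-- The covering complex: the order complex of the poset `CoverVertex R K`. -/
def cover : AbstractSimplicialComplex (CoverVertex R K) where
  faces := {s | s.Nonempty ∧ IsChain (fun x y : CoverVertex R K => x ≤ y) (s : Set _)}
  isRelLowerSet_faces := fun _ ⟨h0, h⟩ => ⟨h0, fun _ hts ht =>
    ⟨ht, h.mono (Finset.coe_subset.2 hts)⟩⟩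
  singleton_mem x := ⟨Finset.singleton_nonempty x, by simp⟩

variable (R K) in
/-- The part of the covering complex over the simplices in `T`. -/
def coverOver (T : Set (Finset ι)) : PreAbstractSimplicialComplex (CoverVertex R K) where
  faces := {s | s ∈ (cover R K).faces ∧ ∀ x ∈ s, ∀ σ ∈ x.chain, σ ∈ T}
  isRelLowerSet_faces := fun _ ⟨h0, h⟩ => ⟨((cover R K).isRelLowerSet_faces h0).1, fun _ hts ht =>
    ⟨((cover R K).isRelLowerSet_faces h0).2 hts ht, fun x hx => h x (hts hx)⟩⟩

theorem triple_mem_coverOver {T : Set (Finset ι)} [DecidableEq (CoverVertex R K)] {x y z : CoverVertex R K}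
    (hxy : x ≤ y) (hyz : y ≤ z) (hz : ∀ σ ∈ z.chain, σ ∈ T) :
    {x, y, z} ∈ (coverOver R K T).faces := by
  have hxz := hxy.trans hyz
  refine ⟨⟨by simp, fun a ha b hb _ => ?_⟩, fun a ha σ hσ => ?_⟩
  · simp only [coe_insert, coe_singleton, Set.mem_insert_iff, Set.mem_singleton_iff] at ha hb
    rcases ha with rfl | rfl | rfl <;> rcases hb with rfl | rfl | rfl <;> simp [*]
  · simp only [mem_insert, mem_singleton] at ha
    have : a ≤ z := by rcases ha with rfl | rfl | rfl <;> simp [*]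
    exact hz σ (this.1 hσ)

end HomologyCover

/-! ### Ordered one-chains modulo boundaries. -/

namespace SimplicialHomology

open Finset

variable {R : Type*} [CommRing R] {V : Type*}

theorem boundary_single_two (x y : V) :
    boundary R V 0 (Finsupp.single ![x, y] 1) =
      Finsupp.single ![y] 1 - Finsupp.single ![x] 1 := by
  have h0 : (![x, y] : Fin 2 → V) ∘ Fin.succAbove 0 = ![y] := by
    funext i; fin_cases i; rfl
  have h1 : (![x, y] : Fin 2 → V) ∘ Fin.succAbove 1 = ![x] := by
    funext i; fin_cases i; rfl
  simp only [boundary, Finsupp.linearCombination_single, one_smul]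
  rw [Fin.sum_univ_two, h0, h1]
  simp [sub_eq_add_neg]

theorem boundary_single_three (x y z : V) :
    boundary R V 1 (Finsupp.single ![x, y, z] 1) =
      Finsupp.single ![y, z] 1 - Finsupp.single ![x, z] 1 + Finsupp.single ![x, y] 1 := by
  have h0 : (![x, y, z] : Fin 3 → V) ∘ Fin.succAbove 0 = ![y, z] := by
    funext i; fin_cases i <;> rfl
  have h1 : (![x, y, z] : Fin 3 → V) ∘ Fin.succAbove 1 = ![x, z] := by
    funext i; fin_cases i <;> rfl
  have h2 : (![x, y, z] : Fin 3 → V) ∘ Fin.succAbove 2 = ![x, y] := by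
    funext i; fin_cases i <;> rfl
  simp only [boundary, Finsupp.linearCombination_single, one_smul]
  rw [Fin.sum_univ_three, h0, h1, h2]
  simp [sub_eq_add_neg]

theorem eq_vec_two (s : Fin 2 → V) : s = ![s 0, s 1] := by
  funext i; fin_cases i <;> rfl

theorem eq_vec_three (s : Fin 3 → V) : s = ![s 0, s 1, s 2] := by
  funext i; fin_cases i <;> rfl

theorem boundary_boundary (c : (Fin 3 → V) →₀ R) : boundary R V 0 (boundary R V 1 c) = 0 := by
  induction c using Finsupp.induction_linear with
  | zero => simp
  | add f g hf hg => rw [map_add, map_add, hf, hg, add_zero]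
  | single s r =>
    rw [eq_vec_three s, ← mul_one r, ← smul_eq_mul, ← Finsupp.smul_single, map_smul, map_smul,
      boundary_single_three, map_add, map_sub, boundary_single_two, boundary_single_two,
      boundary_single_two]
    simp

theorem range_vec_two (x y : V) : Set.range ![x, y] = {x, y} := by
  simp [Matrix.range_cons, Set.pair_comm]

theorem range_vec_three (x y z : V) : Set.range ![x, y, z] = {x, y, z} := by
  ext; simp [Matrix.range_cons]; tauto

variable (R) in
/-- The class of an ordered edge modulo the boundaries in `K`. -/
noncomputable def edgeClass (K : PreAbstractSimplicialComplex V) (x y : V) :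
    ((Fin 2 → V) →₀ R) ⧸ oneBoundaries R K :=
  (oneBoundaries R K).mkQ (Finsupp.single ![x, y] 1)

theorem edgeClass_triangle [DecidableEq V] {K : PreAbstractSimplicialComplex V} {x y z : V}
    (h : {x, y, z} ∈ K.faces) :
    edgeClass R K x z = edgeClass R K x y + edgeClass R K y z := by
  rw [edgeClass, edgeClass, edgeClass, ← map_add, ← sub_eq_zero, ← map_sub, ← LinearMap.mem_ker,
    Submodule.ker_mkQ]
  refine ⟨-Finsupp.single ![x, y, z] 1, neg_mem (Finsupp.single_mem_supported R _
    ⟨_, h, by rw [range_vec_three]; simp⟩), ?_⟩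
  rw [map_neg, boundary_single_three]
  abel

/-- Degenerate tuples are allowed: `(x, x)` is the boundary of `(x, x, x)`. In the same way `(x, y,
x)` gives the antisymmetry below. -/
theorem edgeClass_self [DecidableEq V] {K : PreAbstractSimplicialComplex V} {x : V}
    (h : {x} ∈ K.faces) : edgeClass R K x x = 0 := by
  have := edgeClass_triangle (R := R) (K := K) (x := x) (y := x) (z := x) (by simpa using h)
  simpa using this

theorem edgeClass_symm [DecidableEq V] {K : PreAbstractSimplicialComplex V} {x y : V}
    (h : {x, y} ∈ K.faces) : edgeClass R K x y = -edgeClass R K y x := by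
  have h1 := edgeClass_triangle (R := R) (K := K) (x := x) (y := y) (z := x)
    (by rwa [show ({x, y, x} : Finset V) = {x, y} by ext; simp; tauto])
  rw [edgeClass_self ((K.isRelLowerSet_faces h).2 (by simp) (by simp))] at h1
  exact eq_neg_of_add_eq_zero_left h1.symm

theorem chains_one_induction {K : PreAbstractSimplicialComplex V}
    {P : ((Fin 2 → V) →₀ R) → Prop} (h0 : P 0) (hadd : ∀ f g, P f → P g → P (f + g))
    (hsmul : ∀ (r : R) f, P f → P (r • f))
    (hsingle : ∀ x y, (∃ t ∈ K.faces, (t : Set V) = {x, y}) → P (Finsupp.single ![x, y] 1))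
    {c : (Fin 2 → V) →₀ R} (hc : c ∈ chains R K 1) : P c := by
  rw [chains, Finsupp.supported_eq_span_single] at hc
  refine Submodule.span_induction (p := fun c _ => P c) ?_ h0 (fun f g _ _ => hadd f g)
    (fun r f _ => hsmul r f) hc
  rintro _ ⟨s, ⟨t, ht, hts⟩, rfl⟩
  rw [eq_vec_two s]
  exact hsingle _ _ ⟨t, ht, by rw [hts, ← range_vec_two, ← eq_vec_two]⟩

theorem chains_two_induction {K : PreAbstractSimplicialComplex V}
    {P : ((Fin 3 → V) →₀ R) → Prop} (h0 : P 0) (hadd : ∀ f g, P f → P g → P (f + g))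
    (hsmul : ∀ (r : R) f, P f → P (r • f))
    (hsingle : ∀ x y z, (∃ t ∈ K.faces, (t : Set V) = {x, y, z}) →
      P (Finsupp.single ![x, y, z] 1))
    {c : (Fin 3 → V) →₀ R} (hc : c ∈ chains R K 2) : P c := by
  rw [chains, Finsupp.supported_eq_span_single] at hc
  refine Submodule.span_induction (p := fun c _ => P c) ?_ h0 (fun f g _ _ => hadd f g)
    (fun r f _ => hsmul r f) hc
  rintro _ ⟨s, ⟨t, ht, hts⟩, rfl⟩
  rw [eq_vec_three s]
  exact hsingle _ _ _ ⟨t, ht, by rw [hts, ← range_vec_three, ← eq_vec_three]⟩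

theorem H1map_bijective {K K' : PreAbstractSimplicialComplex V} (h : K ≤ K')
    (hinj : ∀ z ∈ oneCycles R K, z ∈ oneBoundaries R K' → z ∈ oneBoundaries R K)
    (hsurj : ∀ z ∈ oneCycles R K', ∃ w ∈ oneCycles R K, z - w ∈ oneBoundaries R K') :
    Function.Bijective (H1map R h) := by
  constructor
  · rw [← LinearMap.ker_eq_bot, eq_bot_iff]
    intro a ha
    obtain ⟨⟨z, hz⟩, rfl⟩ := Submodule.Quotient.mk_surjective _ a
    have ha' := (Submodule.Quotient.mk_eq_zero _).1 (LinearMap.mem_ker.1 ha)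
    exact (Submodule.Quotient.mk_eq_zero _).2 (hinj z hz ha')
  · intro a
    obtain ⟨⟨z, hz⟩, rfl⟩ := Submodule.Quotient.mk_surjective _ a
    obtain ⟨w, hw, hzw⟩ := hsurj z hz
    exact ⟨Submodule.Quotient.mk ⟨w, hw⟩, ((Submodule.Quotient.eq
      ((oneBoundaries R K').submoduleOf (oneCycles R K')) (x := ⟨z, hz⟩)
      (y := ⟨w, oneCycles_mono R h hw⟩)).2 hzw).symm⟩

end SimplicialHomology

/-! ### Paths between centres of simplices and lifts of edges. -/

namespace HomologyCover

open Finset CoverVertex SimplicialHomology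

variable {ι : Type*} [LinearOrder ι] [Nonempty ι] {R : Type*} [CommRing R]
  {K : PreAbstractSimplicialComplex ι}

section EdgeClassLE

variable {T : Set (Finset ι)}

theorem edgeClass_of_le_of_le {x y z : CoverVertex R K} (hxy : x ≤ y) (hyz : y ≤ z)
    (hz : ∀ σ ∈ z.chain, σ ∈ T) : edgeClass R (coverOver R K T) x z =
      edgeClass R (coverOver R K T) x y + edgeClass R (coverOver R K T) y z := by
  classical
  exact edgeClass_triangle (triple_mem_coverOver hxy hyz hz)

theorem edgeClass_symm_of_le {x y : CoverVertex R K} (hxy : x ≤ y)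
    (hy : ∀ σ ∈ y.chain, σ ∈ T) : edgeClass R (coverOver R K T) y x =
      -edgeClass R (coverOver R K T) x y := by
  classical
  refine edgeClass_symm ?_
  have := triple_mem_coverOver (hxy) le_rfl hy
  rwa [show ({x, y, y} : Finset (CoverVertex R K)) = {y, x} by ext; simp; tauto] at this

end EdgeClassLE

variable [Nonempty (CoverVertex R K)]

variable (R K) in
/-- The vertex of the covering complex given by a potential, with an arbitrary value if `u` is not
a potential on `C`. -/
noncomputable def vertexOf (C : Finset (Finset ι)) (u : Finset ι → ι × ι →₀ R) :
    CoverVertex R K :=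
  open Classical in if h : IsPotential R K C u then mk C u h else Classical.arbitrary _

theorem chain_vertexOf {C : Finset (Finset ι)} {u : Finset ι → ι × ι →₀ R}
    (h : IsPotential R K C u) : (vertexOf R K C u).chain = C := by
  rw [vertexOf, dif_pos h, chain_mk]

theorem diff_vertexOf {C : Finset (Finset ι)} {u : Finset ι → ι × ι →₀ R}
    (h : IsPotential R K C u) {σ τ : Finset ι} (hσ : σ ∈ C) (hτ : τ ∈ C) :
    (vertexOf R K C u).diff σ τ = u σ - u τ := by
  rw [vertexOf, dif_pos h, diff_mk h hσ hτ]

theorem vertexOf_le {C C' : Finset (Finset ι)} {u u' : Finset ι → ι × ι →₀ R}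
    (h : IsPotential R K C u) (h' : IsPotential R K C' u') (hC : C' ⊆ C)
    (hu : ∀ σ ∈ C', ∀ τ ∈ C', u' σ - u' τ = u σ - u τ) :
    vertexOf R K C' u' ≤ vertexOf R K C u := by
  rw [CoverVertex.le_iff, chain_vertexOf h, chain_vertexOf h']
  refine ⟨hC, fun σ hσ τ hτ => ?_⟩
  rw [diff_vertexOf h' hσ hτ, diff_vertexOf h (hC hσ) (hC hτ), hu σ hσ τ hτ]

theorem exists_vertexOf_eq (x : CoverVertex R K) :
    ∃ u, IsPotential R K x.chain u ∧ vertexOf R K x.chain u = x ∧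
      ∀ σ ∈ x.chain, ∀ τ ∈ x.chain, x.diff σ τ = u σ - u τ := by
  obtain ⟨u, hu, h⟩ := x.exists_potential
  refine ⟨u, hu, CoverVertex.ext (chain_vertexOf hu) fun σ hσ τ hτ => ?_, h⟩
  rw [chain_vertexOf hu] at hσ hτ
  rw [diff_vertexOf hu hσ hτ, h σ hσ τ hτ]

variable (R K) in
/-- The vertex at the centre of `σ`. -/
noncomputable def centre (σ : Finset ι) : CoverVertex R K := vertexOf R K {σ} 0

theorem chain_centre {σ : Finset ι} (hσ : σ ∈ K.faces) : (centre R K σ).chain = {σ} :=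
  chain_vertexOf (isPotential_singleton hσ)

/-- Up to constants a single simplex has only one potential, so the vertex over `{σ}` is unique and
lies below every vertex whose chain contains `σ`. -/
theorem centre_le_of_mem {x : CoverVertex R K} {σ : Finset ι} (hσ : σ ∈ x.chain) :
    centre R K σ ≤ x := by
  obtain ⟨u, hu, hx, -⟩ := exists_vertexOf_eq x
  rw [← hx]
  refine vertexOf_le hu (isPotential_singleton (hu.faces σ hσ)) (singleton_subset_iff.2 hσ)
    fun τ hτ ρ hρ => ?_
  rw [mem_singleton.1 hτ, mem_singleton.1 hρ]
  simp

theorem centre_le {C : Finset (Finset ι)} {u : Finset ι → ι × ι →₀ R}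
    (h : IsPotential R K C u) {σ : Finset ι} (hσ : σ ∈ C) : centre R K σ ≤ vertexOf R K C u :=
  centre_le_of_mem (by rwa [chain_vertexOf h])

section EdgeClass

variable {T : Set (Finset ι)}

variable (T) in
/-- The class of the path from the centre of `σ` to the centre of `τ` through a vertex over a chain
containing `σ` and `τ`. -/
noncomputable def pathClass (C : Finset (Finset ι)) (u : Finset ι → ι × ι →₀ R)
    (σ τ : Finset ι) : ((Fin 2 → CoverVertex R K) →₀ R) ⧸ oneBoundaries R (coverOver R K T) :=
  edgeClass R (coverOver R K T) (centre R K σ) (vertexOf R K C u) +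
    edgeClass R (coverOver R K T) (vertexOf R K C u) (centre R K τ)

variable {C C' : Finset (Finset ι)} {u u' : Finset ι → ι × ι →₀ R} {σ τ ρ : Finset ι}

theorem pathClass_eq_sub (h : IsPotential R K C u) (hT : ∀ σ ∈ C, σ ∈ T) (hτ : τ ∈ C) :
    pathClass (K := K) T C u σ τ = edgeClass R (coverOver R K T) (centre R K σ) (vertexOf R K C u) -
      edgeClass R (coverOver R K T) (centre R K τ) (vertexOf R K C u) := by
  rw [pathClass, edgeClass_symm_of_le (centre_le h hτ) (by rwa [chain_vertexOf h]),
    sub_eq_add_neg]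

theorem pathClass_self (h : IsPotential R K C u) (hT : ∀ σ ∈ C, σ ∈ T) (hσ : σ ∈ C) :
    pathClass (K := K) T C u σ σ = 0 := by
  rw [pathClass_eq_sub h hT hσ, sub_self]

theorem pathClass_symm (h : IsPotential R K C u) (hT : ∀ σ ∈ C, σ ∈ T) (hσ : σ ∈ C) (hτ : τ ∈ C) :
    pathClass (K := K) T C u τ σ = -pathClass (K := K) T C u σ τ := by
  rw [pathClass_eq_sub h hT hσ, pathClass_eq_sub h hT hτ, neg_sub]

theorem pathClass_add (h : IsPotential R K C u) (hT : ∀ σ ∈ C, σ ∈ T) (hτ : τ ∈ C) (hρ : ρ ∈ C) :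
    pathClass (K := K) T C u σ τ + pathClass (K := K) T C u τ ρ =
      pathClass (K := K) T C u σ ρ := by
  rw [pathClass_eq_sub h hT hρ, pathClass_eq_sub h hT hτ, pathClass_eq_sub h hT hρ,
    sub_add_sub_cancel]

/-- The vertex over `C'` lies below the vertex over `C`, and the two routes differ by the triangles
that these two vertices form with the centres. -/
theorem pathClass_restrict (h : IsPotential R K C u) (hT : ∀ σ ∈ C, σ ∈ T) (hC : C' ⊆ C)
    (hu : ∀ σ ∈ C', ∀ τ ∈ C', u' σ - u' τ = u σ - u τ) (hσ : σ ∈ C') (hτ : τ ∈ C') :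
    pathClass (K := K) T C' u' σ τ = pathClass (K := K) T C u σ τ := by
  have h' : IsPotential R K C' u' := (h.mono hC ⟨σ, hσ⟩).congr hu
  have hle := vertexOf_le h h' hC hu
  have hT' : ∀ σ ∈ (vertexOf R K C u).chain, σ ∈ T := by rwa [chain_vertexOf h]
  rw [pathClass_eq_sub h' (fun σ hσ => hT σ (hC hσ)) hτ, pathClass_eq_sub h hT (hC hτ),
    edgeClass_of_le_of_le (centre_le h' hσ) hle hT', edgeClass_of_le_of_le (centre_le h' hτ) hle hT',
    add_sub_add_right_eq_sub]

end EdgeClass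

variable (R K) in
/-- The path over the edge from `a` to `b`. -/
noncomputable def edgePath (a b : ι) : (Fin 2 → CoverVertex R K) →₀ R :=
  Finsupp.single ![centre R K {a}, vertexOf R K {{a}, {a, b}} (starPotential R a)] 1 +
    Finsupp.single ![vertexOf R K {{a}, {a, b}} (starPotential R a), centre R K {a, b}] 1 +
    (Finsupp.single ![centre R K {a, b}, vertexOf R K {{b}, {a, b}} (starPotential R b)] 1 +
    Finsupp.single ![vertexOf R K {{b}, {a, b}} (starPotential R b), centre R K {b}] 1)

variable (R K) in
/-- The chain map from the complete graph to the covering complex. -/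
noncomputable def liftEdges : (ι × ι →₀ R) →ₗ[R] (Fin 2 → CoverVertex R K) →₀ R :=
  Finsupp.linearCombination R fun e => edgePath R K e.1 e.2

variable (R K) in
/-- The chain map from the complete graph to the covering complex, modulo boundaries. -/
noncomputable def liftClass (T : Set (Finset ι)) : (ι × ι →₀ R) →ₗ[R]
    ((Fin 2 → CoverVertex R K) →₀ R) ⧸ oneBoundaries R (coverOver R K T) :=
  (oneBoundaries R (coverOver R K T)).mkQ ∘ₗ liftEdges R K

/-! ### Vanishing of the defect. -/

section Defect

variable {T : Set (Finset ι)}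

/-- `edge` only uses increasing pairs. Modulo boundaries the lifted path reverses to its negative,
so the formula holds in either order. -/
theorem liftClass_edge {a b : ι} (hab : a ≠ b) (he : {a, b} ∈ K.faces)
    (hT : ∀ ρ ⊆ ({a, b} : Finset ι), ρ.Nonempty → ρ ∈ T) :
    liftClass R K T (edge R a b) = pathClass T {{a}, {a, b}} (starPotential R a) {a} {a, b} +
      pathClass T {{b}, {a, b}} (starPotential R b) {a, b} {b} := by
  have key : ∀ a b : ι, liftClass R K T (Finsupp.single (a, b) 1) =
      pathClass T {{a}, {a, b}} (starPotential R a) {a} {a, b} +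
      pathClass T {{b}, {a, b}} (starPotential R b) {a, b} {b} := by
    intro a b
    simp only [liftClass, LinearMap.comp_apply, liftEdges, Finsupp.linearCombination_single,
      one_smul, edgePath, map_add]
    rfl
  rcases lt_or_gt_of_ne hab with h | h
  · rw [edge, if_pos h, key]
  · rw [edge, if_neg h.not_gt, if_pos h, map_neg, key, Finset.pair_comm b a, neg_add_rev]
    have mem : ∀ c ∈ ({a, b} : Finset ι), ∀ σ ∈ ({{c}, {a, b}} : Finset (Finset ι)), σ ∈ T := by
      intro c hc σ hσ
      simp only [mem_insert, mem_singleton] at hσ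
      rcases hσ with rfl | rfl
      · exact hT _ (singleton_subset_iff.2 hc) (singleton_nonempty c)
      · exact hT _ Subset.rfl ⟨c, hc⟩
    have ha : a ∈ ({a, b} : Finset ι) := by simp
    have hb : b ∈ ({a, b} : Finset ι) := by simp
    rw [← pathClass_symm (isPotential_star_pair he ha) (mem a ha) (by simp) (by simp),
      ← pathClass_symm (isPotential_star_pair he hb) (mem b hb) (by simp) (by simp)]

variable (R K T) in
/-- The class of the chosen path from the base vertex of `σ` to the centre of `σ`. -/
noncomputable def rayClass (σ : Finset ι) :
    ((Fin 2 → CoverVertex R K) →₀ R) ⧸ oneBoundaries R (coverOver R K T) :=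
  pathClass T {{base σ}, σ} (starPotential R (base σ)) {base σ} σ

variable (K T) in
/-- The class of the closed path that goes along the ray of `σ`, from `σ` to `τ` through a vertex
of the covering complex, back along the ray of `τ`, and back along edges as the potential tells. -/
noncomputable def defect (C : Finset (Finset ι)) (u : Finset ι → ι × ι →₀ R) (σ τ : Finset ι) :
    ((Fin 2 → CoverVertex R K) →₀ R) ⧸ oneBoundaries R (coverOver R K T) :=
  pathClass T C u σ τ - rayClass R K T τ + rayClass R K T σ + liftClass R K T (u τ - u σ)

variable {C C' : Finset (Finset ι)} {u u' : Finset ι → ι × ι →₀ R} {σ τ ρ : Finset ι}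

theorem defect_self (h : IsPotential R K C u) (hT : ∀ σ ∈ C, σ ∈ T) (hσ : σ ∈ C) :
    defect K T C u σ σ = 0 := by
  rw [defect, pathClass_self h hT hσ, sub_self, map_zero]
  abel

theorem defect_add (h : IsPotential R K C u) (hT : ∀ σ ∈ C, σ ∈ T) (hτ : τ ∈ C) (hρ : ρ ∈ C) :
    defect K T C u σ τ + defect K T C u τ ρ = defect K T C u σ ρ := by
  rw [defect, defect, defect, ← pathClass_add h hT (σ := σ) hτ hρ,
    ← sub_add_sub_cancel (u ρ) (u τ) (u σ), map_add]
  generalize liftClass R K T (u ρ - u τ) = a, liftClass R K T (u τ - u σ) = b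
  abel

theorem defect_restrict (h : IsPotential R K C u) (hT : ∀ σ ∈ C, σ ∈ T) (hC : C' ⊆ C)
    (hu : ∀ σ ∈ C', ∀ τ ∈ C', u' σ - u' τ = u σ - u τ) (hσ : σ ∈ C') (hτ : τ ∈ C') :
    defect K T C' u' σ τ = defect K T C u σ τ := by
  rw [defect, defect, pathClass_restrict h hT hC hu hσ hτ, hu τ hτ σ hσ]

theorem defect_eq_step (h : IsPotential R K {τ, σ} u) (hT : τ ∈ T ∧ σ ∈ T) (hne : τ ≠ σ) :
    defect K T {τ, σ} u τ σ = defect K T {τ, σ} (stepPotential σ (u σ - u τ)) τ σ := by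
  refine (defect_restrict h (by simp [hT]) Subset.rfl ?_ (by simp) (by simp)).symm
  simp only [mem_insert, mem_singleton, forall_eq_or_imp, forall_eq, stepPotential_self,
    stepPotential_of_ne hne]
  simp

/-- Put `{a}` below `τ` and extend the potential by the edge from `base τ` to `a`. The defect is
additive along the chain `{a}, τ, σ`, and the part from `{a}` to `τ` vanishes by hypothesis. -/
theorem defect_step_eq {w : ι × ι →₀ R} (hσ : σ ∈ K.faces) (hT : ∀ ρ ⊆ σ, ρ.Nonempty → ρ ∈ T)
    (hτσ : τ ⊂ σ) {a : ι} (ha : a ∈ τ) (haτ : {a} ≠ τ)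
    (hw : w - edge R (base σ) (base τ) ∈ triangles R σ)
    (ih : ∀ u, IsPotential R K {{a}, τ} u → defect K T {{a}, τ} u {a} τ = 0) :
    defect K T {τ, σ} (stepPotential σ w) τ σ =
      defect K T {{a}, σ} (stepPotential σ (w + edge R (base τ) a)) {a} σ := by
  have hne : τ ≠ σ := hτσ.ne
  have haσ : {a} ≠ σ := by
    rintro rfl
    exact hτσ.2 (singleton_subset_iff.2 ha)
  have hpot := isPotential_step hσ ⟨a, ha⟩ hτσ hw
  have hbig := isPotential_insert hpot (ρ := τ) (τ := {a}) (by simp)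
    (by simp [hτσ.1]) (singleton_nonempty a) (singleton_subset_iff.2 ha) (by simp [haτ, haσ])
  set v := Function.update (stepPotential σ w) {a}
    (stepPotential σ w τ - edge R (base τ) (base {a})) with hv
  have va : v {a} = -edge R (base τ) a := by
    rw [hv, Function.update_self, stepPotential_of_ne hne, base_singleton, zero_sub]
  have vτ : v τ = 0 := by
    rw [hv, Function.update_of_ne haτ.symm, stepPotential_of_ne hne]
  have vσ : v σ = w := by
    rw [hv, Function.update_of_ne haσ.symm, stepPotential_self]
  have hTC : ∀ ρ ∈ ({{a}, τ, σ} : Finset (Finset ι)), ρ ∈ T := by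
    simp only [mem_insert, mem_singleton, forall_eq_or_imp, forall_eq]
    exact ⟨hT _ (singleton_subset_iff.2 (hτσ.1 ha)) (singleton_nonempty a),
      hT _ hτσ.1 ⟨a, ha⟩, hT _ Subset.rfl ⟨a, hτσ.1 ha⟩⟩
  have e1 : defect K T {{a}, τ} v {a} τ = defect K T {{a}, τ, σ} v {a} τ :=
    defect_restrict hbig hTC (by simp [insert_subset_iff]) (fun _ _ _ _ => rfl) (by simp) (by simp)
  have e2 : defect K T {τ, σ} (stepPotential σ w) τ σ = defect K T {{a}, τ, σ} v τ σ :=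
    defect_restrict hbig hTC (by simp) (by simp [vτ, vσ, stepPotential_of_ne hne])
      (by simp) (by simp)
  have e3 : defect K T {{a}, σ} (stepPotential σ (w + edge R (base τ) a)) {a} σ =
      defect K T {{a}, τ, σ} v {a} σ := by
    refine defect_restrict hbig hTC (by simp [insert_subset_iff]) ?_ (by simp) (by simp)
    simp [va, vσ, stepPotential_of_ne haσ]
    abel
  rw [ih v (hbig.mono (by simp [insert_subset_iff]) (by simp))] at e1
  rw [e2, e3, ← defect_add hbig hTC (σ := {a}) (τ := τ) (by simp) (by simp), ← e1, zero_add]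

/-- For difference zero the path from `{base σ}` to `σ` is the chosen ray itself. This is the
normalisation from which all other differences are reached. -/
theorem defect_base_eq_zero (hσ : σ ∈ K.faces) (hT : ∀ ρ ⊆ σ, ρ.Nonempty → ρ ∈ T)
    (hne : {base σ} ≠ σ) :
    defect (R := R) K T {{base σ}, σ} (stepPotential σ 0) {base σ} σ = 0 := by
  have h0 := (K.isRelLowerSet_faces hσ).1
  have hb := base_mem h0
  have hpot := isPotential_star_pair (R := R) hσ hb
  have hT1 : {base σ} ∈ T := hT _ (singleton_subset_iff.2 hb) (singleton_nonempty _)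
  have hTC : ∀ ρ ∈ ({{base σ}, σ} : Finset (Finset ι)), ρ ∈ T := by
    simp only [mem_insert, mem_singleton, forall_eq_or_imp, forall_eq]
    exact ⟨hT1, hT _ Subset.rfl h0⟩
  have e := defect_eq_step (T := T) hpot ⟨hT1, hT _ Subset.rfl h0⟩ hne
  have e0 : starPotential R (base σ) σ - starPotential R (base σ) {base σ} = 0 := by
    simp [starPotential]
  rw [e0] at e
  have e1 : rayClass R K T {base σ} = 0 := by
    rw [rayClass, base_singleton, pair_eq_singleton]
    refine pathClass_self (hpot.mono (by simp) (by simp)) (by simpa using hT1) (by simp)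
  rw [← e, defect, e0, map_zero, e1, rayClass]
  abel

/-- The difference is forced over an edge. If the base is `a`, the path is the ray; if it is `b`,
path and ray together form the lifted edge, which the last term of the defect cancels. -/
theorem defect_edge_eq_zero {a b : ι} (hab : a ≠ b) (hσ : {a, b} ∈ K.faces)
    (hT : ∀ ρ ⊆ ({a, b} : Finset ι), ρ.Nonempty → ρ ∈ T) (hu : IsPotential R K {{a}, {a, b}} u) :
    defect K T {{a}, {a, b}} u {a} {a, b} = 0 := by
  have ha : a ∈ ({a, b} : Finset ι) := by simp
  have hb : b ∈ ({a, b} : Finset ι) := by simp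
  have hne : ∀ c, {c} ≠ ({a, b} : Finset ι) := by
    intro c h
    have := congrArg card h
    rw [card_pair hab, card_singleton] at this
    omega
  have hTc : ∀ c ∈ ({a, b} : Finset ι), {c} ∈ T := fun c hc =>
    hT _ (singleton_subset_iff.2 hc) (singleton_nonempty c)
  have hT' := hT _ Subset.rfl ⟨a, ha⟩
  have hw := hu.sub_sub_mem {a, b} (by simp) {a} (by simp) (by simp)
  rw [triangles_pair, Submodule.mem_bot, base_singleton, sub_eq_zero] at hw
  rw [defect_eq_step hu ⟨hTc a ha, hT'⟩ (hne a), hw]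
  have hbase : base ({a, b} : Finset ι) = a ∨ base ({a, b} : Finset ι) = b := by
    simpa using base_mem ⟨a, ha⟩
  rcases hbase with hbase | hbase
  · have := defect_base_eq_zero (R := R) hσ hT (by rw [hbase]; exact hne a)
    rw [hbase] at this ⊢
    rwa [edge_self]
  · rw [hbase]
    have hpa := isPotential_star_pair (R := R) hσ ha
    have hpb := isPotential_star_pair (R := R) hσ hb
    have e := defect_eq_step hpa ⟨hTc a ha, hT'⟩ (hne a)
    have e0 : starPotential R a {a, b} - starPotential R a {a} = edge R b a := by
      simp [starPotential, hbase]
    have e1 : rayClass R K T {a} = 0 := by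
      rw [rayClass, base_singleton, pair_eq_singleton]
      exact pathClass_self (hpa.mono (by simp) (by simp)) (by simpa using hTc a ha) (by simp)
    rw [e0] at e
    rw [← e, defect, e0, e1, rayClass, hbase, edge_symm R b a, map_neg, liftClass_edge hab hσ hT,
      pathClass_symm hpb (by simp [hTc b hb, hT']) (by simp) (by simp)]
    abel

/-- Induction on the size of `σ`. When `τ` is a vertex, the defect is unchanged if the difference
moves by a triangle, so every admissible difference reduces to the ray. A general `τ` reduces to one
of its vertices by `defect_step_eq`. -/
theorem defect_pair_eq_zero (hR : Function.Surjective (Nat.cast : ℕ → R)) (n : ℕ) (hn : σ.card = n) (hσ : σ ∈ K.faces)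
    (hT : ∀ ρ ⊆ σ, ρ.Nonempty → ρ ∈ T) (hτσ : τ ⊂ σ) (hu : IsPotential R K {τ, σ} u) :
    defect K T {τ, σ} u τ σ = 0 := by
  induction n using Nat.strong_induction_on generalizing σ τ u with
  | _ n ih =>
  have hσ0 := (K.isRelLowerSet_faces hσ).1
  have ih' : ∀ τ ⊂ σ, ∀ a ∈ τ, {a} ≠ τ → ∀ u, IsPotential R K {{a}, τ} u →
      defect K T {{a}, τ} u {a} τ = 0 := fun τ hτ a ha hne u hu =>
    ih _ (hn ▸ card_lt_card hτ) rfl ((K.isRelLowerSet_faces hσ).2 hτ.1 ⟨a, ha⟩)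
      (fun ρ hρ => hT ρ (hρ.trans hτ.1)) (_root_.ssubset_iff_subset_ne.2
        ⟨singleton_subset_iff.2 ha, hne⟩) hu
  have hmem : ∀ a ∈ σ, {a} ∈ T := fun a ha =>
    hT _ (singleton_subset_iff.2 ha) (singleton_nonempty a)
  have vert : ∀ a ∈ σ, {a} ≠ σ → ∀ u, IsPotential R K {{a}, σ} u →
      defect K T {{a}, σ} u {a} σ = 0 := by
    intro a ha hne u hu
    -- Moving between vertices of `σ` passes through edges that must be proper faces, so the case
    -- where `σ` is an edge is separate.
    by_cases h2 : ∃ b, b ≠ a ∧ σ = {a, b}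
    · obtain ⟨b, hba, rfl⟩ := h2
      exact defect_edge_eq_zero hba.symm hσ hT hu
    · have hpair : ∀ b ∈ σ, ∀ c ∈ σ, b ≠ c → {b, c} ⊂ σ := by
        intro b hb c hc hbc
        refine _root_.ssubset_iff_subset_ne.2 ⟨by simp [insert_subset_iff, hb, hc], ?_⟩
        rintro rfl
        refine h2 ?_
        simp only [mem_insert, mem_singleton] at ha
        rcases ha with rfl | rfl
        · exact ⟨c, hbc.symm, rfl⟩
        · exact ⟨b, hbc, pair_comm _ _⟩
      have hσne : ∀ b, {b} ≠ σ := by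
        rintro b rfl
        rw [mem_singleton] at ha
        exact hne (by rw [ha])
      -- Both sides equal the defect from the face `{b, c}` to `σ` with a common difference, seen
      -- once from `b` and once from `c`.
      have move : ∀ b ∈ σ, ∀ c ∈ σ, ∀ w : ι × ι →₀ R, w - edge R (base σ) b ∈ triangles R σ →
          defect K T {{b}, σ} (stepPotential σ w) {b} σ =
            defect K T {{c}, σ} (stepPotential σ (w + edge R b c)) {c} σ := by
        intro b hb c hc w hw
        by_cases hbc : b = c
        · subst hbc
          rw [edge_self, add_zero]
        have hss := hpair b hb c hc hbc
        have hbm := base_mem (⟨b, by simp⟩ : ({b, c} : Finset ι).Nonempty)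
        have hne' : ∀ d, {d} ≠ ({b, c} : Finset ι) := by
          intro d h
          have := congrArg card h
          rw [card_pair hbc, card_singleton] at this
          omega
        have hw' : w - edge R (base {b, c}) b - edge R (base σ) (base {b, c}) ∈
            triangles R σ := by
          have e : w - edge R (base {b, c}) b - edge R (base σ) (base {b, c}) =
              (w - edge R (base σ) b) + triangle R (base σ) b (base {b, c}) := by
            rw [triangle, edge_symm R b, edge_symm R (base {b, c}) (base σ)]
            abel
          rw [e]
          exact add_mem hw (triangle_mem (base_mem hσ0) hb (hss.1 hbm))
        have e1 := defect_step_eq hσ hT hss (a := b) (by simp) (hne' b) hw'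
          (ih' _ hss b (by simp) (hne' b))
        have e2 := defect_step_eq hσ hT hss (a := c) (by simp) (hne' c) hw'
          (ih' _ hss c (by simp) (hne' c))
        rw [e1, sub_add_cancel] at e2
        rw [e2]
        congr 2
        simp only [mem_insert, mem_singleton] at hbm
        rcases hbm with h | h
        · rw [h, edge_self, sub_zero]
        · rw [h, edge_self, edge_symm R c b]
          abel_nf
      have hb := base_mem hσ0
      have loop : ∀ z ∈ triangles R σ, ∀ w ∈ triangles R σ,
          defect K T {{base σ}, σ} (stepPotential σ (w + z)) {base σ} σ =
            defect K T {{base σ}, σ} (stepPotential σ w) {base σ} σ := by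
        intro z hz
        induction hz using Submodule.span_induction with
        | mem z hz =>
          obtain ⟨x, hx, y, hy, t, ht, rfl⟩ := hz
          -- Carry the lower end around the triangle from `base σ` through `x` and `y` and back.
          have tri : ∀ x ∈ σ, ∀ y ∈ σ, ∀ w ∈ triangles R σ,
              defect K T {{base σ}, σ} (stepPotential σ (w + triangle R (base σ) x y))
                {base σ} σ = defect K T {{base σ}, σ} (stepPotential σ w) {base σ} σ := by
            intro x hx y hy w hw
            rw [move _ hb x hx w (by simpa using hw), move x hx y hy _ (by simpa using hw),
              move y hy _ hb, triangle]
            · congr 2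
              abel
            · have e : w + edge R (base σ) x + edge R x y - edge R (base σ) y =
                  w + triangle R (base σ) x y := by
                rw [triangle, edge_symm R y]
                abel
              rw [e]
              exact add_mem hw (triangle_mem hb hx hy)
          intro w hw
          -- Coning from `base σ`: the edges through the base cancel in pairs.
          have e : w + triangle R x y t = w + triangle R (base σ) x y +
              triangle R (base σ) y t + triangle R (base σ) t x := by
            simp only [triangle]
            rw [edge_symm R y (base σ), edge_symm R t (base σ), edge_symm R x (base σ)]
            abel
          rw [e, tri t ht x hx _ (add_mem (add_mem hw (triangle_mem hb hx hy))
            (triangle_mem hb hy ht)), tri y hy t ht _ (add_mem hw (triangle_mem hb hx hy)),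
            tri x hx y hy _ hw]
        | zero => intro w _; rw [add_zero]
        | add z z' hz hz' h h' =>
          intro w hw
          rw [← add_assoc, h' _ (add_mem hw hz), h w hw]
        | smul r z hz h =>
          -- Translation invariance is only known to be additive in `z`. Scalars are therefore
          -- treated as repeated sums, which suffices because natural numbers exhaust `R`.
          obtain ⟨k, rfl⟩ := hR r
          induction k with
          | zero => intro w _; simp
          | succ k hk =>
            intro w hw
            rw [Nat.cast_succ, add_smul, one_smul, ← add_assoc,
              h _ (add_mem hw (Submodule.smul_mem _ _ hz)), hk w hw]
      have hw := hu.sub_sub_mem σ (by simp) {a} (by simp) (by simpa using ha)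
      rw [base_singleton] at hw
      -- From difference zero at the base, translate by the cycle `hw` and then move to `a`; this
      -- produces exactly `u σ - u {a}`.
      have e1 := loop _ hw 0 (zero_mem _)
      rw [zero_add, defect_base_eq_zero hσ hT (hσne _), move _ hb a ha _ (by simpa using hw),
        sub_add_cancel] at e1
      rw [defect_eq_step hu ⟨hmem a ha, hT σ Subset.rfl hσ0⟩ hne, e1]
  have hτ0 := (K.isRelLowerSet_faces (hu.faces τ (by simp))).1
  obtain ⟨a, ha⟩ := id hτ0
  by_cases haτ : {a} = τ
  · subst haτ
    exact vert a (hτσ.1 ha) hτσ.ne u hu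
  · have hw := hu.sub_sub_mem σ (by simp) τ (by simp) hτσ.1
    have hne : {a} ≠ σ := by
      rintro rfl
      exact hτσ.2 (singleton_subset_iff.2 ha)
    rw [defect_eq_step hu ⟨hT τ hτσ.1 hτ0, hT σ Subset.rfl hσ0⟩ hτσ.ne,
      defect_step_eq hσ hT hτσ ha haτ hw (ih' τ hτσ a ha haτ)]
    refine vert a (hτσ.1 ha) hne _ (isPotential_step hσ (singleton_nonempty a)
      (_root_.ssubset_iff_subset_ne.2 ⟨singleton_subset_iff.2 (hτσ.1 ha), hne⟩) ?_)
    rw [base_singleton]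
    have e : u σ - u τ + edge R (base τ) a - edge R (base σ) a =
        (u σ - u τ - edge R (base σ) (base τ)) + triangle R (base σ) (base τ) a := by
      rw [triangle, edge_symm R a]
      abel
    rw [e]
    exact add_mem hw (triangle_mem (base_mem hσ0) (hτσ.1 (base_mem hτ0)) (hτσ.1 ha))

theorem defect_eq_zero (hR : Function.Surjective (Nat.cast : ℕ → R)) (hT : ∀ σ ∈ T, ∀ ρ ⊆ σ, ρ.Nonempty → ρ ∈ T) (hu : IsPotential R K C u)
    (hC : ∀ σ ∈ C, σ ∈ T) (hσ : σ ∈ C) (hτ : τ ∈ C) : defect K T C u σ τ = 0 := by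
  have main : ∀ σ ∈ C, ∀ τ ∈ C, τ ⊆ σ → defect K T C u τ σ = 0 := by
    intro σ hσ τ hτ h
    by_cases hne : τ = σ
    · rw [hne, defect_self hu hC hσ]
    · have hsub : {τ, σ} ⊆ C := by simp [insert_subset_iff, hσ, hτ]
      rw [← defect_restrict hu hC hsub (fun _ _ _ _ => rfl) (by simp) (by simp)]
      exact defect_pair_eq_zero hR _ rfl (hu.faces σ hσ) (hT σ (hC σ hσ))
        (_root_.ssubset_iff_subset_ne.2 ⟨h, hne⟩) (hu.mono hsub (by simp))
  rcases hu.total σ hσ τ hτ with h | h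
  · exact main τ hτ σ hσ h
  · have := defect_add hu hC hτ hσ (σ := σ)
    rwa [main σ hσ τ hτ h, add_zero, defect_self hu hC hσ] at this

end Defect

end HomologyCover

/-! ### First homology over a family of simplices. -/

namespace HomologyCover

open Finset CoverVertex SimplicialHomology

variable {ι : Type*} [LinearOrder ι] [Nonempty ι] {R : Type*} [CommRing R]
  {K : PreAbstractSimplicialComplex ι}

/-- A chosen simplex of the chain under `x`. -/
noncomputable def pick (x : CoverVertex R K) : Finset ι := x.chain_nonempty.choose

theorem pick_mem (x : CoverVertex R K) : pick x ∈ x.chain := x.chain_nonempty.choose_spec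

/-- The change of the potential along an edge. -/
noncomputable def potentialChange (x y : CoverVertex R K) : ι × ι →₀ R :=
  open Classical in
  if x ≤ y then y.diff (pick y) (pick x) else x.diff (pick y) (pick x)

/-- The change can be read at any vertex above both ends. At the top vertex of a triangle the three
changes are differences of one potential, hence `chainChange` kills boundaries. -/
theorem potentialChange_eq {x y z : CoverVertex R K} (hxz : x ≤ z) (hyz : y ≤ z)
    (h : x ≤ y ∨ y ≤ x) : potentialChange x y = z.diff (pick y) (pick x) := by
  by_cases hxy : x ≤ y
  · rw [potentialChange, if_pos hxy, hyz.2 _ (pick_mem y) _ (hxy.1 (pick_mem x))]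
  · rw [potentialChange, if_neg hxy,
      hxz.2 _ ((h.resolve_left hxy).1 (pick_mem y)) _ (pick_mem x)]

variable (R K) in
/-- The change of the potential along a one-chain. -/
noncomputable def chainChange : ((Fin 2 → CoverVertex R K) →₀ R) →ₗ[R] (ι × ι →₀ R) :=
  Finsupp.linearCombination R fun s => potentialChange (s 0) (s 1)

theorem chainChange_single (x y : CoverVertex R K) :
    chainChange R K (Finsupp.single ![x, y] 1) = potentialChange x y := by
  simp [chainChange, Finsupp.linearCombination_single]

theorem exists_greatest_of_mem_cover {s : Finset (CoverVertex R K)} (hs : s ∈ (cover R K).faces) :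
    ∃ z ∈ s, ∀ x ∈ s, x ≤ z := by
  obtain ⟨z, hz, hmax⟩ := s.exists_maximal hs.1
  exact ⟨z, hz, fun x hx => (hs.2.total hx hz).elim id fun h => hmax hx h⟩

theorem chainChange_eq_zero_of_mem_oneBoundaries {T : Set (Finset ι)}
    {c : (Fin 2 → CoverVertex R K) →₀ R} (hc : c ∈ oneBoundaries R (coverOver R K T)) :
    chainChange R K c = 0 := by
  obtain ⟨b, hb, rfl⟩ := hc
  refine chains_two_induction (P := fun b => chainChange R K (boundary R _ 1 b) = 0) ?_ ?_ ?_ ?_ hb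
  · rw [map_zero, map_zero]
  · intro f g hf hg
    rw [map_add, map_add, hf, hg, add_zero]
  · intro r f hf
    rw [map_smul, map_smul, hf, smul_zero]
  · rintro x y z ⟨t, ht, hts⟩
    obtain ⟨m, -, hm⟩ := exists_greatest_of_mem_cover ht.1
    have hx : x ∈ t := by rw [← mem_coe, hts]; simp
    have hy : y ∈ t := by rw [← mem_coe, hts]; simp
    have hz : z ∈ t := by rw [← mem_coe, hts]; simp
    have htot := ht.1.2
    rw [boundary_single_three, map_add, map_sub, chainChange_single, chainChange_single,
      chainChange_single, potentialChange_eq (hm y hy) (hm z hz) (htot.total hy hz),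
      potentialChange_eq (hm x hx) (hm z hz) (htot.total hx hz),
      potentialChange_eq (hm x hx) (hm y hy) (htot.total hx hy),
      ← m.diff_add ((hm z hz).1 (pick_mem z)) ((hm y hy).1 (pick_mem y)) ((hm x hx).1 (pick_mem x))]
    abel

/-- Over `σ`, a difference is an edge between base vertices in `σ` plus triangles with vertices in
`σ`. The span uses increasing pairs because these are the generators whose lifts are examined later.
-/
theorem chainChange_mem_span {σ : Finset ι} {c : (Fin 2 → CoverVertex R K) →₀ R}
    (hc : c ∈ chains R (coverOver R K {τ | τ ⊆ σ}) 1) : chainChange R K c ∈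
      Submodule.span R {e | ∃ x ∈ σ, ∃ y ∈ σ, x < y ∧ e = Finsupp.single (x, y) (1 : R)} := by
  set M := Submodule.span R {e | ∃ x ∈ σ, ∃ y ∈ σ, x < y ∧ e = Finsupp.single (x, y) (1 : R)}
    with hM
  have htri : triangles R σ ≤ M := by
    refine Submodule.span_le.2 ?_
    rintro _ ⟨a, ha, b, hb, d, hd, rfl⟩
    exact add_mem (add_mem (edge_mem_span ha hb) (edge_mem_span hb hd)) (edge_mem_span hd ha)
  have hdiff : ∀ z : CoverVertex R K, (∀ τ ∈ z.chain, τ ⊆ σ) → ∀ τ ∈ z.chain, ∀ ρ ∈ z.chain,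
      z.diff τ ρ ∈ M := by
    intro z hz τ hτ ρ hρ
    obtain ⟨u, hu, hd⟩ := z.exists_potential
    have key : ∀ τ ∈ z.chain, ∀ ρ ∈ z.chain, ρ ⊆ τ → u τ - u ρ ∈ M := by
      intro τ hτ ρ hρ h
      have hb : ∀ τ ∈ z.chain, base τ ∈ σ := fun τ hτ =>
        hz τ hτ (base_mem (K.isRelLowerSet_faces (hu.faces τ hτ)).1)
      have := add_mem (htri (triangles_mono (hz τ hτ) (hu.sub_sub_mem τ hτ ρ hρ h)))
        (edge_mem_span (hb τ hτ) (hb ρ hρ))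
      rwa [sub_add_cancel] at this
    rw [hd τ hτ ρ hρ]
    rcases hu.total τ hτ ρ hρ with h | h
    · rw [← neg_sub]
      exact neg_mem (key ρ hρ τ hτ h)
    · exact key τ hτ ρ hρ h
  refine chains_one_induction (P := fun c => chainChange R K c ∈ M) ?_ ?_ ?_ ?_ hc
  · rw [map_zero]
    exact zero_mem _
  · intro f g hf hg
    rw [map_add]
    exact add_mem hf hg
  · intro r f hf
    rw [map_smul]
    exact Submodule.smul_mem _ _ hf
  · rintro x y ⟨t, ht, hts⟩
    have hx : x ∈ t := by rw [← mem_coe, hts]; simp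
    have hy : y ∈ t := by rw [← mem_coe, hts]; simp
    obtain ⟨m, hmt, hm⟩ := exists_greatest_of_mem_cover ht.1
    rw [chainChange_single, potentialChange_eq (hm x hx) (hm y hy) (ht.1.2.total hx hy)]
    exact hdiff m (ht.2 m hmt) _ ((hm y hy).1 (pick_mem y)) _ ((hm x hx).1 (pick_mem x))

theorem single_mem_chains {T : Set (Finset ι)} {x y : CoverVertex R K} (h : x ≤ y ∨ y ≤ x)
    (hx : ∀ σ ∈ x.chain, σ ∈ T) (hy : ∀ σ ∈ y.chain, σ ∈ T) :
    Finsupp.single ![x, y] (1 : R) ∈ chains R (coverOver R K T) 1 := by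
  classical
  refine Finsupp.single_mem_supported R _ ⟨{x, y}, ?_, by rw [range_vec_two]; simp⟩
  rcases h with h | h
  · have := triple_mem_coverOver h le_rfl hy
    rwa [show ({x, y, y} : Finset (CoverVertex R K)) = {x, y} by ext; simp] at this
  · have := triple_mem_coverOver h le_rfl hx
    rwa [show ({y, x, x} : Finset (CoverVertex R K)) = {x, y} by ext; simp; tauto] at this

variable [Nonempty (CoverVertex R K)] {T : Set (Finset ι)}

variable (T) in
/-- The class of a path from the base vertex of `pick x` to `x`. -/
noncomputable def rayTo (x : CoverVertex R K) :
    ((Fin 2 → CoverVertex R K) →₀ R) ⧸ oneBoundaries R (coverOver R K T) :=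
  edgeClass R (coverOver R K T) (centre R K (pick x)) x + rayClass R K T (pick x)

/-- This is the vanishing of the defect solved for the edge. The ray terms telescope, so on a cycle
only the lift of the potential change remains. -/
theorem edgeClass_eq_of_le (hR : Function.Surjective (Nat.cast : ℕ → R))
    (hT : ∀ σ ∈ T, ∀ ρ ⊆ σ, ρ.Nonempty → ρ ∈ T) {x y : CoverVertex R K} (hxy : x ≤ y)
    (hy : ∀ σ ∈ y.chain, σ ∈ T) :
    edgeClass R (coverOver R K T) x y =
      rayTo T y - rayTo T x - liftClass R K T (potentialChange x y) := by
  have hx := edgeClass_of_le_of_le (T := T) (centre_le_of_mem (pick_mem x)) hxy hy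
  obtain ⟨u, hu, hyu, hd⟩ := exists_vertexOf_eq y
  have hpx := hxy.1 (pick_mem x)
  have hpy := pick_mem y
  have h0 := defect_eq_zero hR hT hu hy hpx hpy
  rw [defect, pathClass_eq_sub hu hy hpy, hyu, ← hd _ hpy _ hpx,
    ← potentialChange_eq hxy le_rfl (Or.inl hxy)] at h0
  rw [rayTo, rayTo, ← sub_eq_zero, ← h0, hx]
  abel

theorem edgeClass_eq (hR : Function.Surjective (Nat.cast : ℕ → R))
    (hT : ∀ σ ∈ T, ∀ ρ ⊆ σ, ρ.Nonempty → ρ ∈ T) {x y : CoverVertex R K}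
    (h : ∃ t ∈ (coverOver R K T).faces, (t : Set (CoverVertex R K)) = {x, y}) :
    edgeClass R (coverOver R K T) x y =
      rayTo T y - rayTo T x - liftClass R K T (potentialChange x y) := by
  obtain ⟨t, ht, hts⟩ := h
  have hx : x ∈ t := by rw [← mem_coe, hts]; simp
  have hy : y ∈ t := by rw [← mem_coe, hts]; simp
  rcases ht.1.2.total hx hy with hxy | hyx
  · exact edgeClass_eq_of_le hR hT hxy (ht.2 y hy)
  · have e : potentialChange x y = -potentialChange y x := by
      rw [potentialChange_eq le_rfl hyx (Or.inr hyx), potentialChange_eq hyx le_rfl (Or.inl hyx)]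
      have h1 := x.diff_add (hyx.1 (pick_mem y)) (pick_mem x) (hyx.1 (pick_mem y))
      have h2 := x.diff_add (hyx.1 (pick_mem y)) (hyx.1 (pick_mem y)) (hyx.1 (pick_mem y))
      rw [add_eq_left.1 h2] at h1
      exact eq_neg_of_add_eq_zero_left h1
    rw [edgeClass_symm_of_le hyx (ht.2 x hx), edgeClass_eq_of_le hR hT hyx (ht.2 x hx), e, map_neg]
    abel

variable (R K T) in
/-- The linear extension of `rayTo`. -/
noncomputable def rayToChain : ((Fin 1 → CoverVertex R K) →₀ R) →ₗ[R]
    ((Fin 2 → CoverVertex R K) →₀ R) ⧸ oneBoundaries R (coverOver R K T) :=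
  Finsupp.linearCombination R fun s => rayTo T (s 0)

theorem mkQ_eq (hR : Function.Surjective (Nat.cast : ℕ → R))
    (hT : ∀ σ ∈ T, ∀ ρ ⊆ σ, ρ.Nonempty → ρ ∈ T) {c : (Fin 2 → CoverVertex R K) →₀ R}
    (hc : c ∈ chains R (coverOver R K T) 1) :
    (oneBoundaries R (coverOver R K T)).mkQ c =
      rayToChain R K T (boundary R _ 0 c) - liftClass R K T (chainChange R K c) := by
  refine chains_one_induction (P := fun c => (oneBoundaries R (coverOver R K T)).mkQ c =
      rayToChain R K T (boundary R _ 0 c) - liftClass R K T (chainChange R K c)) ?_ ?_ ?_ ?_ hc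
  · simp only [map_zero, sub_zero]
  · intro f g hf hg
    simp only [map_add, hf, hg]
    abel
  · intro r f hf
    simp only [map_smul, hf, smul_sub]
  · intro x y h
    rw [boundary_single_two, chainChange_single]
    refine (edgeClass_eq hR hT h).trans ?_
    simp [rayToChain, Finsupp.linearCombination_single]

/-- The sign is positive because the potential changes by `-edge a b` along the lifted path from `a`
to `b`. -/
theorem mem_oneBoundaries_add_liftEdges (hR : Function.Surjective (Nat.cast : ℕ → R))
    (hT : ∀ σ ∈ T, ∀ ρ ⊆ σ, ρ.Nonempty → ρ ∈ T) {c : (Fin 2 → CoverVertex R K) →₀ R}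
    (hc : c ∈ oneCycles R (coverOver R K T)) :
    c + liftEdges R K (chainChange R K c) ∈ oneBoundaries R (coverOver R K T) := by
  have h := mkQ_eq hR hT hc.1
  rw [LinearMap.mem_ker.1 hc.2, map_zero, zero_sub] at h
  rw [← Submodule.ker_mkQ (oneBoundaries R (coverOver R K T)), LinearMap.mem_ker, map_add, h]
  exact neg_add_cancel _

theorem edgePath_mem_chains {a b : ι} (he : {a, b} ∈ K.faces) (ha : {a} ∈ T) (hb : {b} ∈ T)
    (hab : {a, b} ∈ T) : edgePath R K a b ∈ chains R (coverOver R K T) 1 := by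
  have hpa := isPotential_star_pair (R := R) he (a := a) (by simp)
  have hpb := isPotential_star_pair (R := R) he (a := b) (by simp)
  have hfa : {a} ∈ K.faces := hpa.faces _ (by simp)
  have hfb : {b} ∈ K.faces := hpb.faces _ (by simp)
  have ta : ∀ σ ∈ (centre R K {a}).chain, σ ∈ T := by simpa [chain_centre hfa] using ha
  have tb : ∀ σ ∈ (centre R K {b}).chain, σ ∈ T := by simpa [chain_centre hfb] using hb
  have te : ∀ σ ∈ (centre R K {a, b}).chain, σ ∈ T := by simpa [chain_centre he] using hab
  have tpa : ∀ σ ∈ (vertexOf R K {{a}, {a, b}} (starPotential R a)).chain, σ ∈ T := by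
    simpa [chain_vertexOf hpa] using ⟨ha, hab⟩
  have tpb : ∀ σ ∈ (vertexOf R K {{b}, {a, b}} (starPotential R b)).chain, σ ∈ T := by
    simpa [chain_vertexOf hpb] using ⟨hb, hab⟩
  exact add_mem (add_mem (single_mem_chains (Or.inl (centre_le hpa (by simp))) ta tpa)
    (single_mem_chains (Or.inr (centre_le hpa (by simp))) tpa te))
    (add_mem (single_mem_chains (Or.inl (centre_le hpb (by simp))) te tpb)
    (single_mem_chains (Or.inr (centre_le hpb (by simp))) tpb tb))

theorem boundary_edgePath (a b : ι) : boundary R _ 0 (edgePath R K a b) =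
    Finsupp.single ![centre R K {b}] 1 - Finsupp.single ![centre R K {a}] 1 := by
  simp only [edgePath, map_add, boundary_single_two]
  abel

/-- Both families are closed under nonempty faces, so a cycle over either is governed there by its
potential change, and that change does not depend on the family. -/
theorem H1map_coverOver_bijective (hR : Function.Surjective (Nat.cast : ℕ → R)) {σ : Finset ι}
    (hσ : σ ∈ K.faces) (h : coverOver R K {τ | τ ⊂ σ} ≤ coverOver R K {τ | τ ⊆ σ}) :
    Function.Bijective (H1map R h) := by
  have hT : ∀ τ ∈ {τ | τ ⊆ σ}, ∀ ρ ⊆ τ, ρ.Nonempty → ρ ∈ {τ | τ ⊆ σ} :=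
    fun τ hτ ρ hρ _ => hρ.trans hτ
  have hT' : ∀ τ ∈ {τ | τ ⊂ σ}, ∀ ρ ⊆ τ, ρ.Nonempty → ρ ∈ {τ | τ ⊂ σ} :=
    fun τ hτ ρ hρ _ => lt_of_le_of_lt hρ hτ
  refine H1map_bijective h (fun z hz hzb => ?_) fun z hz => ?_
  · have := mem_oneBoundaries_add_liftEdges hR hT' hz
    rwa [chainChange_eq_zero_of_mem_oneBoundaries hzb, map_zero, add_zero] at this
  · have hmem := mem_oneBoundaries_add_liftEdges hR hT hz
    have hspan := chainChange_mem_span hz.1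
    have hcyc : boundary R _ 0 (liftEdges R K (chainChange R K z)) = 0 := by
      obtain ⟨b, -, hb⟩ := hmem
      have := congrArg (boundary R _ 0) hb
      rw [boundary_boundary, map_add, LinearMap.mem_ker.1 hz.2] at this
      exact (this.trans (zero_add _)).symm
    have hface : ∀ a ∈ σ, ∀ b ∈ σ, {a, b} ∈ K.faces := fun a ha b hb =>
      (K.isRelLowerSet_faces hσ).2 (by simp [insert_subset_iff, ha, hb]) (by simp)
    -- With at least three vertices, every edge of `σ` is a proper face, so the lift lies over the
    -- boundary. Otherwise the change itself has to vanish.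
    by_cases hcard : 2 < σ.card
    · refine ⟨-liftEdges R K (chainChange R K z), neg_mem ⟨?_, LinearMap.mem_ker.2 hcyc⟩,
        by rwa [sub_neg_eq_add]⟩
      refine Submodule.span_induction (p := fun w _ => liftEdges R K w ∈
        chains R (coverOver R K {τ | τ ⊂ σ}) 1) ?_ ?_ ?_ ?_ hspan
      · rintro _ ⟨a, ha, b, hb, -, rfl⟩
        rw [liftEdges, Finsupp.linearCombination_single, one_smul]
        have hss : ∀ τ ⊆ σ, τ.card ≤ 2 → τ ∈ {τ | τ ⊂ σ} := fun τ hτ h2 =>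
          _root_.ssubset_iff_subset_ne.2 ⟨hτ, by rintro rfl; omega⟩
        exact edgePath_mem_chains (hface a ha b hb)
          (hss _ (singleton_subset_iff.2 ha) (by simp))
          (hss _ (singleton_subset_iff.2 hb) (by simp))
          (hss _ (by simp [insert_subset_iff, ha, hb]) card_le_two)
      · rw [map_zero]
        exact zero_mem _
      · intro f g _ _ hf hg
        rw [map_add]
        exact add_mem hf hg
      · intro r f _ hf
        rw [map_smul]
        exact Submodule.smul_mem _ _ hf
    · have hzero : chainChange R K z = 0 := by
        by_cases hex : ∃ a ∈ σ, ∃ b ∈ σ, a < b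
        · obtain ⟨a, ha, b, hb, hab⟩ := hex
          have hσe : σ = {a, b} := (eq_of_subset_of_card_le (by simp [insert_subset_iff, ha, hb])
            (by rw [card_pair hab.ne]; omega)).symm
          have hset : {e | ∃ x ∈ σ, ∃ y ∈ σ, x < y ∧ e = Finsupp.single (x, y) (1 : R)} =
              {Finsupp.single (a, b) (1 : R)} := by
            ext e
            constructor
            · rintro ⟨x, hx, y, hy, hxy, rfl⟩
              rw [hσe, mem_insert, mem_singleton] at hx hy
              rcases hx with rfl | rfl <;> rcases hy with rfl | rfl
              · exact absurd hxy (lt_irrefl _)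
              · rfl
              · exact absurd hxy hab.not_gt
              · exact absurd hxy (lt_irrefl _)
            · rintro rfl
              exact ⟨a, ha, b, hb, hab, rfl⟩
          rw [hset, Submodule.mem_span_singleton] at hspan
          obtain ⟨r, hr⟩ := hspan
          rw [← hr, map_smul, map_smul, liftEdges, Finsupp.linearCombination_single, one_smul,
            boundary_edgePath] at hcyc
          have hne : (![centre R K {a}] : Fin 1 → CoverVertex R K) ≠ ![centre R K {b}] := by
            intro e
            have e1 : (centre R K {a}).chain = (centre R K {b}).chain :=
              congrArg chain (congrFun e 0)
            have hfs : ∀ c ∈ σ, {c} ∈ K.faces := fun c hc => by simpa using hface c hc c hc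
            rw [chain_centre (hfs a ha), chain_centre (hfs b hb), singleton_inj,
              singleton_inj] at e1
            exact hab.ne e1
          -- The lift is a multiple of a path with distinct ends; the coefficient of its boundary at
          -- the end over `b` is the multiple.
          have := DFunLike.congr_fun hcyc ![centre R K {b}]
          rw [Finsupp.smul_apply, Finsupp.sub_apply, Finsupp.single_eq_same,
            Finsupp.single_eq_of_ne' hne, sub_zero, smul_eq_mul, mul_one] at this
          rw [← hr, this, Finsupp.zero_apply, zero_smul]
        · have hset : {e | ∃ x ∈ σ, ∃ y ∈ σ, x < y ∧ e = Finsupp.single (x, y) (1 : R)} = ∅ := by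
            rw [Set.eq_empty_iff_forall_notMem]
            rintro e ⟨x, hx, y, hy, hxy, -⟩
            exact hex ⟨x, hx, y, hy, hxy⟩
          rwa [hset, Submodule.span_empty, Submodule.mem_bot] at hspan
      refine ⟨0, zero_mem _, ?_⟩
      rwa [hzero, map_zero, add_zero, ← sub_zero z] at hmem

end HomologyCover

/-! ### Projection to the second barycentric subdivision. -/

namespace HomologyCover

open CoverVertex SimplicialOrbit SimplicialHomology

section Projection

variable {ι : Type*} [LinearOrder ι] [Nonempty ι] {R : Type*} [CommRing R]
  {K : PreAbstractSimplicialComplex ι}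

theorem image_chain_mem_faces [DecidableEq (Finset (Finset ι))] {s : Finset (CoverVertex R K)}
    (hs : s ∈ (cover R K).faces) :
    s.image chain ∈ (barycentricSubdivision (barycentricSubdivision K)).faces := by
  refine ⟨hs.1.image _, fun C hC => ?_, ?_⟩
  · obtain ⟨x, -, rfl⟩ := Finset.mem_image.1 hC
    exact chain_mem_faces x
  · intro C hC D hD _
    obtain ⟨x, hx, rfl⟩ := Finset.mem_image.1 hC
    obtain ⟨y, hy, rfl⟩ := Finset.mem_image.1 hD
    exact (hs.2.total hx hy).imp And.left And.left

theorem chain_injOn {s : Finset (CoverVertex R K)} (hs : s ∈ (cover R K).faces) :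
    Set.InjOn chain (s : Set (CoverVertex R K)) := by
  obtain ⟨z, -, hz⟩ := exists_greatest_of_mem_cover hs
  exact fun x hx y hy h => eq_of_le_of_le (hz x hx) (hz y hy) h

theorem isSimplicialAction_cover {G : Type*} [AddGroup G] [AddAction G (CoverVertex R K)]
    (e : G → DeckGroup ι R) (hG : ∀ (g : G) (x : CoverVertex R K), g +ᵥ x = e g +ᵥ x) :
    IsSimplicialAction G (cover R K).toPreAbstractSimplicialComplex := by
  refine fun g s hs => ⟨hs.1.map, fun x hx y hy _ => ?_⟩
  obtain ⟨x, hx', rfl⟩ := Finset.mem_map.1 hx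
  obtain ⟨y, hy', rfl⟩ := Finset.mem_map.1 hy
  have hle : ∀ x y : CoverVertex R K, x ≤ y → g +ᵥ x ≤ g +ᵥ y := fun x y h => by
    rw [hG, hG]
    exact vadd_le_vadd _ h
  exact (hs.2.total hx' hy').imp (hle x y) (hle y x)

variable [Fintype (CoverVertex R K)]

theorem exists_support_face {w : CoverVertex R K → ℝ}
    (hw : w ∈ polyhedron (cover R K).toPreAbstractSimplicialComplex) :
    ∃ s ∈ (cover R K).faces, ∀ x, x ∈ s ↔ w x ≠ 0 := by
  classical
  obtain ⟨hw, s, hs, hws⟩ := hw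
  refine ⟨Finset.univ.filter fun x => w x ≠ 0, ((cover R K).isRelLowerSet_faces hs).2
    (fun x hx => hws x (by simpa using hx)) ?_, fun x => by simp⟩
  obtain ⟨x, hx⟩ := exists_ne_zero_of_mem_stdSimplex hw
  exact ⟨x, by simpa using hx⟩

theorem preimage_eq_coverOver {E : Type*} {f : (CoverVertex R K → ℝ) → E} {S : Set E} {T : Set (Finset ι)}
    (h : ∀ w ∈ polyhedron (cover R K).toPreAbstractSimplicialComplex,
      f w ∈ S ↔ ∀ x, w x ≠ 0 → ∀ τ ∈ x.chain, τ ∈ T) :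
    preimage (cover R K).toPreAbstractSimplicialComplex f S = coverOver R K T := by
  refine PreAbstractSimplicialComplex.ext (Set.ext fun s => and_congr_right fun hs => ⟨?_, ?_⟩)
  · intro hf x hx
    have hu := uniformWeight_mem_stdSimplex hs.1
    -- The barycentre of `s` has all of `s` as its support, so it tests every vertex at once.
    refine (h (uniformWeight s) ⟨hu, s, hs, fun v hv => (uniformWeight_ne_zero_iff s v).1 hv⟩).1
      (hf _ hu fun v hv => (uniformWeight_ne_zero_iff s v).1 hv) x
      ((uniformWeight_ne_zero_iff s x).2 hx)
  · intro hT w hw hws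
    exact (h w ⟨hw, s, hs, hws⟩).2 fun x hx => hT x (hws x hx)

theorem polyhedron_coverOver {E : Type*} {f : (CoverVertex R K → ℝ) → E} {S : Set E} {T : Set (Finset ι)}
    (h : ∀ w ∈ polyhedron (cover R K).toPreAbstractSimplicialComplex,
      f w ∈ S ↔ ∀ x, w x ≠ 0 → ∀ τ ∈ x.chain, τ ∈ T) :
    polyhedron (coverOver R K T) =
      polyhedron (cover R K).toPreAbstractSimplicialComplex ∩ f ⁻¹' S := by
  ext w
  constructor
  · rintro ⟨hw, s, hs, hws⟩
    have hw' : w ∈ polyhedron (cover R K).toPreAbstractSimplicialComplex := ⟨hw, s, hs.1, hws⟩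
    exact ⟨hw', (h w hw').2 fun x hx => hs.2 x (hws x hx)⟩
  · rintro ⟨hw, hS⟩
    obtain ⟨s, hs, hws⟩ := exists_support_face hw
    exact ⟨hw.1, s, ⟨hs, fun x hx => (h w hw).1 hS x ((hws x).1 hx)⟩, fun x hx => (hws x).2 hx⟩

/-- The projection of the covering complex to the second barycentric subdivision. -/
noncomputable def projection : (CoverVertex R K → ℝ) → (Finset (Finset ι) → ℝ) :=
  affineExtension fun x => Pi.single x.chain 1

theorem projection_ne_zero_iff {w : CoverVertex R K → ℝ} (hw : w ∈ stdSimplex ℝ (CoverVertex R K))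
    (C : Finset (Finset ι)) : projection w C ≠ 0 ↔ ∃ x, w x ≠ 0 ∧ x.chain = C := by
  rw [projection, affineExtension_ne_zero_iff hw]
  · simp [Pi.single_apply, eq_comm (a := C)]
  · intro x D
    rw [Pi.single_apply]
    split_ifs <;> norm_num

theorem projection_apply_chain {w : CoverVertex R K → ℝ}
    (hw : w ∈ polyhedron (cover R K).toPreAbstractSimplicialComplex) {x : CoverVertex R K}
    (hx : w x ≠ 0) : projection w x.chain = w x := by
  obtain ⟨s, hs, hws⟩ := exists_support_face hw
  rw [projection, affineExtension_apply, Finset.sum_eq_single x]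
  · simp
  · intro y _ hy
    by_cases hwy : w y = 0
    · rw [hwy, zero_mul]
    · rw [Pi.single_apply, if_neg, mul_zero]
      exact fun h => hy (chain_injOn hs ((hws y).2 hwy) ((hws x).2 hx) h.symm)
  · simp

/-- The top vertices of the two supports lie over the same chain, so some `g` carries one to the
other. Lower vertices are determined by their chains, so `g` matches the supports, and the weights
agree because the projection preserves them. -/
theorem projection_eq_iff {w w' : CoverVertex R K → ℝ}
    (hw : w ∈ polyhedron (cover R K).toPreAbstractSimplicialComplex)
    (hw' : w' ∈ polyhedron (cover R K).toPreAbstractSimplicialComplex) :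
    projection w = projection w' ↔ ∃ g : DeckGroup ι R, ∀ x, w' (g +ᵥ x) = w x := by
  constructor
  · intro h
    obtain ⟨s, hs, hws⟩ := exists_support_face hw
    obtain ⟨s', hs', hws'⟩ := exists_support_face hw'
    have hex : ∀ x, w x ≠ 0 → ∃ y, w' y ≠ 0 ∧ y.chain = x.chain := fun x hx =>
      (projection_ne_zero_iff hw'.1 _).1 (h ▸ (projection_ne_zero_iff hw.1 _).2 ⟨x, hx, rfl⟩)
    have hex' : ∀ y, w' y ≠ 0 → ∃ x, w x ≠ 0 ∧ x.chain = y.chain := fun y hy =>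
      (projection_ne_zero_iff hw.1 _).1 (h ▸ (projection_ne_zero_iff hw'.1 _).2 ⟨y, hy, rfl⟩)
    obtain ⟨z, hz, hmax⟩ := exists_greatest_of_mem_cover hs
    obtain ⟨z', hz', hmax'⟩ := exists_greatest_of_mem_cover hs'
    have hzz : z.chain = z'.chain := by
      obtain ⟨y, hy, hyz⟩ := hex z ((hws z).1 hz)
      obtain ⟨x, hx, hxz⟩ := hex' z' ((hws' z').1 hz')
      exact (hyz ▸ (hmax' y ((hws' y).2 hy)).1).antisymm (hxz ▸ (hmax x ((hws x).2 hx)).1)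
    obtain ⟨g, hg⟩ := exists_vadd_eq z z' hzz
    have key : ∀ x, w x ≠ 0 → w' (g +ᵥ x) ≠ 0 := by
      intro x hx
      obtain ⟨y, hy, hyx⟩ := hex x hx
      have e : g +ᵥ x = y := eq_of_le_of_le (z := z')
        (hg ▸ vadd_le_vadd g (hmax x ((hws x).2 hx))) (hmax' y ((hws' y).2 hy))
        (by rw [chain_vadd, hyx])
      rwa [e]
    refine ⟨g, fun x => ?_⟩
    by_cases hx : w x = 0
    · by_contra hne
      rw [hx] at hne
      obtain ⟨y, hy, hyx⟩ := hex' _ hne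
      have e : g +ᵥ y = g +ᵥ x := chain_injOn hs' ((hws' _).2 (key y hy)) ((hws' _).2 hne)
        (by rw [chain_vadd, hyx])
      have e' : y = x := AddAction.injective g e
      exact hy (e' ▸ hx)
    · rw [← projection_apply_chain hw hx, ← projection_apply_chain hw' (key x hx), h, chain_vadd]
  · rintro ⟨g, hg⟩
    funext C
    rw [projection, affineExtension_apply, affineExtension_apply,
      ← Equiv.sum_comp (AddAction.toPerm g) fun x => w' x * _]
    refine Finset.sum_congr rfl fun x _ => ?_
    rw [AddAction.toPerm_apply, hg, chain_vadd]

variable [Fintype ι]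

theorem projection_mem_polyhedron {w : CoverVertex R K → ℝ}
    (hw : w ∈ polyhedron (cover R K).toPreAbstractSimplicialComplex) :
    projection w ∈ polyhedron (barycentricSubdivision (barycentricSubdivision K)) := by
  classical
  obtain ⟨hw, s, hs, hws⟩ := hw
  refine ⟨affineExtension_mem_stdSimplex hw fun x _ => single_mem_stdSimplex ℝ _, s.image chain,
    image_chain_mem_faces hs, fun C hC => ?_⟩
  obtain ⟨x, hx, rfl⟩ := (projection_ne_zero_iff hw C).1 hC
  exact Finset.mem_image_of_mem _ (hws x hx)

/-- Choose a vertex over the largest chain; its restrictions to the smaller chains lift the whole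
simplex. -/
theorem exists_projection_eq {v : Finset (Finset ι) → ℝ}
    (hv : v ∈ polyhedron (barycentricSubdivision (barycentricSubdivision K))) :
    ∃ w ∈ polyhedron (cover R K).toPreAbstractSimplicialComplex, projection w = v := by
  classical
  obtain ⟨hv, c, ⟨hc0, hcK, hc⟩, hvc⟩ := hv
  obtain ⟨D, hD, hmax⟩ := exists_max_of_chain hc0 hc
  obtain ⟨z, hz⟩ := exists_coverVertex (R := R) (hcK D hD)
  have hlift : ∀ C ∈ c, ∃ y ≤ z, y.chain = C := fun C hC =>
    exists_le_of_chain_subset z (hz ▸ hmax C hC) (hcK C hC).1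
  have : Nonempty (CoverVertex R K) := ⟨z⟩
  choose! f hf hfc using hlift
  have hfv : ∀ C, v C ≠ 0 → (f C).chain = C := fun C hC => hfc C (hvc C hC)
  refine ⟨affineExtension (fun C => Pi.single (f C) 1) v,
    ⟨affineExtension_mem_stdSimplex hv fun C _ => single_mem_stdSimplex ℝ _, c.image f,
      ⟨hc0.image f, ?_⟩, fun x hx => ?_⟩, ?_⟩
  · intro x hx y hy _
    obtain ⟨C, hC, rfl⟩ := Finset.mem_image.1 hx
    obtain ⟨C', hC', rfl⟩ := Finset.mem_image.1 hy
    have key : ∀ C ∈ c, ∀ C' ∈ c, C ⊆ C' → f C ≤ f C' := fun C hC C' hC' h =>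
      ⟨by rwa [hfc C hC, hfc C' hC'], fun σ hσ τ hτ => by
        rw [(hf C hC).2 σ hσ τ hτ, (hf C' hC').2 σ _ τ _]
        · rw [hfc C' hC']
          rw [hfc C hC] at hσ
          exact h hσ
        · rw [hfc C' hC']
          rw [hfc C hC] at hτ
          exact h hτ⟩
    exact (hc.total hC hC').imp (key C hC C' hC') (key C' hC' C hC)
  · rw [affineExtension_ne_zero_iff hv] at hx
    · obtain ⟨C, hC, hCx⟩ := hx
      rw [Pi.single_apply, ne_eq, ite_eq_right_iff, Classical.not_imp] at hCx
      exact hCx.1 ▸ Finset.mem_image_of_mem f (hvc C hC)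
    · intro C y
      rw [Pi.single_apply]
      split_ifs <;> norm_num
  · rw [projection, affineExtension_comp]
    have e : affineExtension (fun C => affineExtension (fun x : CoverVertex R K =>
        (Pi.single x.chain 1 : Finset (Finset ι) → ℝ)) (Pi.single (f C) 1)) v =
        affineExtension (fun C => Pi.single C 1) v := by
      refine affineExtension_congr fun C hC => ?_
      rw [affineExtension_single, hfv C hC]
    rw [e]
    funext C
    simp [affineExtension_apply, Pi.single_apply]

end Projection

section SubdivisionPoint

variable {ι : Type*} [Fintype ι] {K : PreAbstractSimplicialComplex ι}
  {E : Type*} [AddCommGroup E] [Module ℝ E] {φ : ι → E}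

/-- The points of the second barycentric subdivision in space. -/
noncomputable def subdivisionPoint (φ : ι → E) (C : Finset (Finset ι)) : E :=
  affineExtension (fun s => affineExtension φ (uniformWeight s)) (uniformWeight C)

theorem injOn_subdivisionPoint (hφ : Set.InjOn (affineExtension φ) (polyhedron K)) :
    Set.InjOn (affineExtension (subdivisionPoint φ))
      (polyhedron (barycentricSubdivision (barycentricSubdivision K))) :=
  injOn_barycentricSubdivision (injOn_barycentricSubdivision hφ)

theorem isSubdivision_subdivisionPoint (hφ : Set.InjOn (affineExtension φ) (polyhedron K)) :
    IsSubdivision (realization (barycentricSubdivision (barycentricSubdivision K))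
      (subdivisionPoint φ) (injOn_subdivisionPoint hφ)) (realization K φ hφ) :=
  (isSubdivision_barycentricSubdivision (injOn_barycentricSubdivision hφ)).trans
    (isSubdivision_barycentricSubdivision hφ)

end SubdivisionPoint

/-! ### The orbit map and preimages of simplices. -/

section OrbitMap

variable {ι : Type*} [LinearOrder ι] [Nonempty ι] [Fintype ι] {R : Type*} [CommRing R]
  {K : PreAbstractSimplicialComplex ι} [Fintype (CoverVertex R K)]
  {E : Type*} [AddCommGroup E] [Module ℝ E] {φ : ι → E}

theorem affineExtension_subdivisionPoint_chain (w : CoverVertex R K → ℝ) :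
    affineExtension (fun x : CoverVertex R K => subdivisionPoint φ x.chain) w =
      affineExtension (subdivisionPoint φ) (projection w) := by
  rw [projection, affineExtension_comp]
  simp only [affineExtension_single]

/-- In the coordinates of `K`, the support of the image point is the union of all simplices in the
chains that carry weight. The hypothesis on `σ` admits the empty set, which occurs among the proper
faces in the boundary. -/
theorem affineExtension_mem_closedSimplex_iff [DecidableEq E]
    (hφ : Set.InjOn (affineExtension φ) (polyhedron K))
    {w : CoverVertex R K → ℝ} (hw : w ∈ polyhedron (cover R K).toPreAbstractSimplicialComplex)
    {σ : Finset ι} (hσ : σ.Nonempty → σ ∈ K.faces) :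
    affineExtension (fun x : CoverVertex R K => subdivisionPoint φ x.chain) w ∈
      closedSimplex (σ.image φ) ↔ ∀ x, w x ≠ 0 → ∀ τ ∈ x.chain, τ ⊆ σ := by
  have h1 := projection_mem_polyhedron hw
  have h2 := barycentre_mem_polyhedron h1
  have h3 := barycentre_mem_polyhedron h2
  have hsupp : ∀ v, affineExtension uniformWeight (affineExtension uniformWeight (projection w)) v
      ≠ 0 ↔ ∃ x, w x ≠ 0 ∧ ∃ τ ∈ x.chain, v ∈ τ := by
    intro v
    rw [affineExtension_ne_zero_iff h2.1 uniformWeight_nonneg]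
    simp only [affineExtension_ne_zero_iff h1.1 uniformWeight_nonneg, uniformWeight_ne_zero_iff,
      projection_ne_zero_iff hw.1]
    constructor
    · rintro ⟨τ, ⟨_, ⟨x, hx, rfl⟩, hτ⟩, hv⟩
      exact ⟨x, hx, τ, hτ, hv⟩
    · rintro ⟨x, hx, τ, hτ, hv⟩
      exact ⟨τ, ⟨_, ⟨x, hx, rfl⟩, hτ⟩, hv⟩
  have e : affineExtension (fun x : CoverVertex R K => subdivisionPoint φ x.chain) w =
      affineExtension φ (affineExtension uniformWeight
        (affineExtension uniformWeight (projection w))) := by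
    rw [affineExtension_subdivisionPoint_chain, affineExtension_comp, affineExtension_comp]
    rfl
  rw [e, mem_closedSimplex_image_iff]
  constructor
  · rintro ⟨y, hy, hyσ, hye⟩ x hx τ hτ v hv
    obtain ⟨a, ha⟩ := exists_ne_zero_of_mem_stdSimplex hy
    have := hφ ⟨hy, σ, hσ ⟨a, hyσ a ha⟩, hyσ⟩ h3 hye
    subst this
    exact hyσ v ((hsupp v).2 ⟨x, hx, τ, hτ, hv⟩)
  · intro h
    refine ⟨_, h3.1, fun v hv => ?_, rfl⟩
    obtain ⟨x, hx, τ, hτ, hv⟩ := (hsupp v).1 hv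
    exact h x hx τ hτ hv

/-- All simplices that carry weight lie in the largest simplex under the top vertex of the support,
so a single proper face contains the point. -/
theorem affineExtension_mem_simplexBoundary_iff [DecidableEq E]
    (hφ : Set.InjOn (affineExtension φ) (polyhedron K))
    {w : CoverVertex R K → ℝ} (hw : w ∈ polyhedron (cover R K).toPreAbstractSimplicialComplex)
    (hinj : Function.Injective φ) {σ : Finset ι} (hσ : σ ∈ K.faces) :
    affineExtension (fun x : CoverVertex R K => subdivisionPoint φ x.chain) w ∈
      simplexBoundary (σ.image φ) ↔ ∀ x, w x ≠ 0 → ∀ τ ∈ x.chain, τ ⊂ σ := by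
  have hf : ∀ τ ⊂ σ, τ.Nonempty → τ ∈ K.faces := fun τ hτ h =>
    (K.isRelLowerSet_faces hσ).2 hτ.1 h
  simp only [simplexBoundary, Set.mem_iUnion, exists_prop]
  constructor
  · rintro ⟨t, hts, ht⟩ x hx τ hτ
    obtain ⟨ρ, hρ, rfl⟩ := Finset.subset_image_iff.1 hts.1
    have hρ' : ρ ⊂ σ := by
      refine ⟨hρ, fun h => hts.2 (Finset.image_subset_image h)⟩
    exact lt_of_le_of_lt
      ((affineExtension_mem_closedSimplex_iff hφ hw (hf ρ hρ')).1 ht x hx τ hτ) hρ'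
  · intro h
    obtain ⟨s, hs, hws⟩ := exists_support_face hw
    obtain ⟨z, hz, hmax⟩ := exists_greatest_of_mem_cover hs
    obtain ⟨τ, hτ, hτmax⟩ := exists_max_of_chain z.chain_nonempty (chain_mem_faces z).2.2
    have hτσ := h z ((hws z).1 hz) τ hτ
    refine ⟨τ.image φ, (Finset.image_ssubset_image hinj).2 hτσ,
      (affineExtension_mem_closedSimplex_iff hφ hw (hf τ hτσ)).2 fun x hx ρ hρ => ?_⟩
    exact hτmax ρ ((hmax x ((hws x).2 hx)).1 hρ)

theorem isOrbitMap_cover (hφ : Set.InjOn (affineExtension φ) (polyhedron K)) {G : Type*}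
    [AddGroup G] [AddAction G (CoverVertex R K)] (e : G → DeckGroup ι R)
    (he : Function.Surjective e) (hG : ∀ (g : G) (x : CoverVertex R K), g +ᵥ x = e g +ᵥ x) :
    IsOrbitMap G (cover R K).toPreAbstractSimplicialComplex
      (realization (barycentricSubdivision (barycentricSubdivision K)) (subdivisionPoint φ)
        (injOn_subdivisionPoint hφ))
      (fun x => subdivisionPoint φ x.chain) where
  simplicial s hs := by
    classical
    refine ⟨(s.image chain).image (subdivisionPoint φ), ⟨_, image_chain_mem_faces hs, by simp⟩, ?_⟩
    rw [Finset.coe_image, Finset.coe_image, Set.image_image]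
  image_eq := by
    rw [realization_space]
    ext z
    constructor
    · rintro ⟨w, hw, rfl⟩
      exact ⟨_, projection_mem_polyhedron hw, (affineExtension_subdivisionPoint_chain w).symm⟩
    · rintro ⟨v, hv, rfl⟩
      obtain ⟨w, hw, rfl⟩ := exists_projection_eq (R := R) hv
      exact ⟨w, hw, affineExtension_subdivisionPoint_chain w⟩
  fibre_eq_orbit w hw w' hw' := by
    rw [affineExtension_subdivisionPoint_chain, affineExtension_subdivisionPoint_chain,
      (injOn_subdivisionPoint hφ).eq_iff (projection_mem_polyhedron hw)
        (projection_mem_polyhedron hw'), projection_eq_iff hw hw', he.exists]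
    simp only [hG]

end OrbitMap

/-! ### Renaming vertices and finiteness. -/

section Vertices

variable {E : Type*} [AddCommGroup E] [Module ℝ E]

/-- The abstract complex of `L`, with vertices renamed. -/
def abstractComplex {V : Type*} (L : Geometry.SimplicialComplex ℝ E) (φ : V ↪ E) :
    PreAbstractSimplicialComplex V where
  faces := {s | s.map φ ∈ L.faces}
  isRelLowerSet_faces := fun _ hs => ⟨Finset.map_nonempty.1 (L.isRelLowerSet_faces hs).1,
    fun _ hts ht => (L.isRelLowerSet_faces hs).2 (Finset.map_subset_map.2 hts) (ht.map)⟩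

theorem exists_eq_map {V : Type*} [Fintype V] (L : Geometry.SimplicialComplex ℝ E) (φ : V ↪ E)
    (hφ : L.vertices ⊆ Set.range φ) {t : Finset E} (ht : t ∈ L.faces) :
    ∃ s ∈ (abstractComplex L φ).faces, t = s.map φ := by
  classical
  have : (Finset.univ.filter fun v => φ v ∈ t).map φ = t := by
    ext x
    simp only [Finset.mem_map, Finset.mem_filter, Finset.mem_univ, true_and]
    constructor
    · rintro ⟨v, hv, rfl⟩
      exact hv
    · intro hx
      obtain ⟨v, rfl⟩ := hφ (L.down_closed ht (Finset.singleton_subset_iff.2 hx)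
        (Finset.singleton_nonempty x))
      exact ⟨v, hx, rfl⟩
  refine ⟨_, ?_, this.symm⟩
  change Finset.map φ _ ∈ L.faces
  rwa [this]

theorem realization_abstractComplex {V : Type*} [Fintype V] (L : Geometry.SimplicialComplex ℝ E)
    (φ : V ↪ E) (hφ : L.vertices ⊆ Set.range φ)
    (hinj : Set.InjOn (affineExtension φ) (polyhedron (abstractComplex L φ))) :
    realization (abstractComplex L φ) φ hinj = L := by
  refine Geometry.SimplicialComplex.ext (Set.ext fun t => ⟨?_, fun ht => ?_⟩)
  · rintro ⟨s, hs, hts⟩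
    rw [← Finset.coe_map, Finset.coe_inj] at hts
    rw [hts]
    exact hs
  · obtain ⟨s, hs, rfl⟩ := exists_eq_map L φ hφ ht
    exact ⟨s, hs, by simp⟩

theorem finite_vertices (L : Geometry.SimplicialComplex ℝ E) (h : L.faces.Finite) :
    L.vertices.Finite :=
  h.preimage (f := fun x => ({x} : Finset E)) fun _ _ _ _ h => Finset.singleton_injective h

end Vertices

theorem H1map_bijective_of_eq {R : Type*} [CommRing R] {V : Type*}
    {K₁ K₂ K₁' K₂' : PreAbstractSimplicialComplex V} (h : K₁ ≤ K₂) (h₁ : K₁ = K₁') (h₂ : K₂ = K₂')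
    (hb : ∀ h' : K₁' ≤ K₂', Function.Bijective (H1map R h')) :
    Function.Bijective (H1map R h) := by
  subst h₁ h₂
  exact hb h

instance {ι : Type*} [LinearOrder ι] [Nonempty ι] [Finite ι] {R : Type*} [CommRing R] [Finite R]
    {K : PreAbstractSimplicialComplex ι} : Finite (CoverVertex R K) :=
  have : Finite (ι × ι →₀ R) := Finite.of_injective (fun f => (f : ι × ι → R))
    DFunLike.coe_injective
  inferInstanceAs (Finite {_x : Finset (Finset ι) × (Finset ι → Finset ι → ι × ι →₀ R) // _})

theorem exists_linearEquiv_pi {F I M : Type*} [Field F] [Finite I] [AddCommGroup M] [Module F M]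
    [Module.Finite F M] (T : I → Submodule F M) :
    ∃ m : ℕ, Nonempty ((Fin m → F) ≃ₗ[F] ((i : I) → T i)) :=
  ⟨_, ⟨(Module.finBasis F ((i : I) → T i)).equivFun.symm⟩⟩

end HomologyCover

/-! ### The theorem. -/

open HomologyCover

theorem lemma16 {E : Type*} [NormedAddCommGroup E] [NormedSpace ℝ E]
    (p : ℕ) [Fact p.Prime] (L : Geometry.SimplicialComplex ℝ E)
    (hfinite : L.faces.Finite) (hconnected : IsConnected L.space) :
    ∃ (m : ℕ) (V : Type) (_ : Fintype V) (_ : AddAction (Fin m → ZMod p) V)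
      (K : AbstractSimplicialComplex V) (L' : Geometry.SimplicialComplex ℝ E) (φ : V → E),
      SimplicialOrbit.IsSimplicialAction (Fin m → ZMod p) K.toPreAbstractSimplicialComplex ∧
      SimplicialOrbit.IsSubdivision L' L ∧
      SimplicialOrbit.IsOrbitMap (Fin m → ZMod p) K.toPreAbstractSimplicialComplex L' φ ∧
      ∀ σ ∈ L.faces,
        SimplicialOrbit.polyhedron
            (SimplicialOrbit.preimage K.toPreAbstractSimplicialComplex
              (SimplicialOrbit.affineExtension φ) (SimplicialOrbit.closedSimplex σ)) =
          SimplicialOrbit.polyhedron K.toPreAbstractSimplicialComplex ∩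
            SimplicialOrbit.affineExtension φ ⁻¹' SimplicialOrbit.closedSimplex σ ∧
        SimplicialOrbit.polyhedron
            (SimplicialOrbit.preimage K.toPreAbstractSimplicialComplex
              (SimplicialOrbit.affineExtension φ) (SimplicialOrbit.simplexBoundary σ)) =
          SimplicialOrbit.polyhedron K.toPreAbstractSimplicialComplex ∩
            SimplicialOrbit.affineExtension φ ⁻¹' SimplicialOrbit.simplexBoundary σ ∧
        Function.Bijective
          (SimplicialHomology.H1map (ZMod p)
            (SimplicialOrbit.preimage_mono K.toPreAbstractSimplicialComplex
              (SimplicialOrbit.affineExtension φ) (SimplicialOrbit.simplexBoundary_subset σ))) := by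
  classical
  have hV := finite_vertices L hfinite
  have := hV.to_subtype
  obtain ⟨n, ⟨e⟩⟩ := Finite.exists_equiv_fin L.vertices
  -- Indexing the vertices by `Fin n` supplies the linear order that orients edges and places the
  -- cover in `Type`.
  let φ : Fin n ↪ E := e.symm.toEmbedding.trans (Function.Embedding.subtype _)
  have hφr : L.vertices ⊆ Set.range φ := fun x hx => ⟨e ⟨x, hx⟩, by simp [φ]⟩
  obtain ⟨z, hz⟩ := hconnected.nonempty
  obtain ⟨t, ht, -⟩ := Geometry.SimplicialComplex.mem_space_iff.1 hz
  obtain ⟨s, hs, rfl⟩ := exists_eq_map L φ hφr ht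
  have hs0 := ((abstractComplex L φ).isRelLowerSet_faces hs).1
  have : Nonempty (Fin n) := ⟨hs0.choose⟩
  have : NeZero p := ⟨(Fact.out : p.Prime).ne_zero⟩
  have hφ : Set.InjOn (SimplicialOrbit.affineExtension φ)
      (SimplicialOrbit.polyhedron (abstractComplex L φ)) :=
    SimplicialOrbit.injOn_affineExtension_of_simplicialComplex L _ φ φ.injective fun s hs => hs
  have hR : Function.Surjective (Nat.cast : ℕ → ZMod p) := ZMod.natCast_zmod_surjective
  let K := abstractComplex L φ
  let _ : Fintype (CoverVertex (ZMod p) K) := Fintype.ofFinite _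
  have : Nonempty (CoverVertex (ZMod p) K) := ⟨(exists_coverVertex (C := {s}) ⟨Finset.singleton_nonempty s,
    by simpa using hs, by simp⟩).choose⟩
  -- Since `ZMod p` is a field, the product of the cycle spaces has a finite basis; its dimension is
  -- the exponent `m`.
  obtain ⟨m, ⟨b⟩⟩ := exists_linearEquiv_pi (F := ZMod p)
    fun σ : Finset (Fin n) => triangles (ZMod p) σ
  let b' : (Fin m → ZMod p) →+ DeckGroup (Fin n) (ZMod p) := b.toAddEquiv.toAddMonoidHom
  let A : AddAction (Fin m → ZMod p) (CoverVertex (ZMod p) K) :=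
    AddAction.compHom _ b'
  have hA : ∀ (g : Fin m → ZMod p) (x : CoverVertex (ZMod p) K), g +ᵥ x = b' g +ᵥ x := fun _ _ => rfl
  have hsub := isSubdivision_subdivisionPoint hφ
  rw [realization_abstractComplex L φ hφr hφ] at hsub
  refine ⟨m, CoverVertex (ZMod p) K, inferInstance, A, cover (ZMod p) K, _,
    fun x => subdivisionPoint φ x.chain, isSimplicialAction_cover b' hA, hsub,
    isOrbitMap_cover hφ b' b.surjective hA, fun t ht => ?_⟩
  obtain ⟨σ, hσ, rfl⟩ := exists_eq_map L φ hφr ht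
  rw [Finset.map_eq_image]
  have h₁ := fun w hw => affineExtension_mem_closedSimplex_iff (R := ZMod p) (K := K) hφ (w := w) hw
    (σ := σ) fun _ => hσ
  have h₂ := fun w hw => affineExtension_mem_simplexBoundary_iff (R := ZMod p) (K := K) hφ (w := w)
    hw φ.injective hσ
  have e₁ := preimage_eq_coverOver (T := {τ | τ ⊆ σ}) h₁
  have e₂ := preimage_eq_coverOver (T := {τ | τ ⊂ σ}) h₂
  exact ⟨(congrArg _ e₁).trans (polyhedron_coverOver h₁),
    (congrArg _ e₂).trans (polyhedron_coverOver h₂),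
    H1map_bijective_of_eq _ e₂ e₁ fun h => H1map_coverOver_bijective (K := K) hR hσ h⟩
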